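/- **Definitions.** A *path* in a directed graph $(V,E)$, $E\subseteq V\times V$, is a nonempty finite sequence of vertices in which consecutive vertices are joined by an edge; repetitions are allowed. A *constrained control flow graph* (cCFG) consists of a finite directed graph $(V,E)$, vertices $s\neq t$ such that no edge enters $s$, no edge leaves $t$ and every vertex is reachable from $s$ and reaches $t$, and a set of constraints $C\subseteq V\times V$. A *test set* is a set of paths from $s$ to $t$. It *respects the NEGATIVE constraints* $C$ if for no $(x,y)\in C$ it contains a path of the form $p_1.x.p_2.y.p_3$, where $p_1,p_2,p_3$ are possibly empty sequences; it *achieves edge coverage* if every edge in $E$ occurs on one of its paths. **The algorithm HasEdgeCoverageWithNegative.** Let $C^v$ be the set of vertices that occur in constraints, and let $\overline{C!}$ be the set of sequences $c$ of distinct elements of $C^v$ such that, for all $(x,y)\in C$ with $x\ne y$ and both $x$ and $y$ in $c$, the vertex $y$ stands before $x$ in $c$. Start with $T=\varnothing$. For each $c\in\overline{C!}$ let $E'$ be the set of edges on no path in $T$, and while $E'\neq\varnothing$ take $(u,v)\in E'$ and run FindProperPath$(G,c,(u,v))$; if it returns a path $p$, add $p$ to $T$ and remove the edges of $p$ from $E'$,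 otherwise remove $(u,v)$ from $E'$. Finally answer True if every edge is on a path in $T$, and False otherwise. FindProperPath$(G,c,(u,v))$, for $c=(c_1,\dots,c_n)$: if $s$ or $t$ is in $C^v$ but not in $c$, return $\varnothing$. For $1\le j\le n+1$ let $R_j=\{c_j,\dots,c_n\}$ and let $A_j$ consist of the vertices outside $C^v$ and of those $x\in R_j$ for which no $(x,y)\in C$ has $y\in R_j$. Start with $p=(s)$. For $j=1,\dots,n$ extend $p$ to a path ending in $c_j$, all new vertices before the last one being in $A_j$ (nothing is added if $p$ already ends in $c_j$); if $p$ does not yet contain the edge $(u,v)$, choose the extension so that it does, if this is possible. Then extend $p$ in the same way, with $A_{n+1}$, to a path ending in $t$, where the extension must contain $(u,v)$ if $p$ does not yet contain it. If a required extension does not exist, return $\varnothing$; otherwise return $p$. **Theorem.** There are a computable function $f:\mathbb N\to\mathbb N$ and a polynomial $q$ such that HasEdgeCoverageWithNegative, implemented as a program on list data (with unit-cost pairing, projections, equality tests of vertex names, branching on the empty list and function calls), halts on every cCFG $G=(V,E,s,t,C)$, given by its lists of vertices, edges and constraints, after at most $f(|C|)\cdot q(|V|+|E|)$ steps, and answers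 True if and only if there is a test set that achieves edge coverage for $G$ and respects the NEGATIVE constraints $C$. In particular, the problem whether such a test set exists is fixed-parameter tractable with respect to the number $|C|$ of constraints. -/

import Mathlib

/-! ### Constrained control flow graphs, test sets, NEGATIVE constraints -/

namespace CFGTest

/-- A path in the directed graph with edge set `E`: a nonempty sequence of vertices in which
consecutive vertices are joined by an edge (vertices and edges may repeat). -/
def IsPath {V : Type} (E : Finset (V × V)) (p : List V) : Prop :=
  p ≠ [] ∧ List.IsChain (fun a b => (a, b) ∈ E) p

/-- `w` is reachable from `v`: some path starts in `v` and ends in `w`. -/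
def Reachable {V : Type} (E : Finset (V × V)) (v w : V) : Prop :=
  ∃ p : List V, IsPath E p ∧ p.head? = some v ∧ p.getLast? = some w

/-- A constrained control flow graph with vertex set `V`, source `s`, sink `t` and set of
constraints `C`. (That there are at least two vertices follows from `s ≠ t`.) -/
structure CCFG (V : Type) where
  /-- the edges -/
  E : Finset (V × V)
  /-- the source -/
  s : V
  /-- the sink -/
  t : V
  /-- the constraints -/
  C : Finset (V × V)
  s_ne_t : s ≠ t
  /-- the in-degree of `s` is zero -/
  no_edge_into_s : ∀ v, (v, s) ∉ E
  /-- the out-degree of `t` is zero -/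
  no_edge_from_t : ∀ v, (t, v) ∉ E
  reachable_from_s : ∀ v, Reachable E s v
  t_reachable : ∀ v, Reachable E v t

namespace CCFG

variable {V : Type}

/-- A test path: a path of `G` from `s` to `t`. -/
def IsTestPath (G : CCFG V) (p : List V) : Prop :=
  IsPath G.E p ∧ p.head? = some G.s ∧ p.getLast? = some G.t

/-- A test set is a set of test paths. -/
def IsTestSet (G : CCFG V) (TS : Set (List V)) : Prop :=
  ∀ p ∈ TS, G.IsTestPath p

/-- A test set respects the NEGATIVE constraints: for no constraint `(x, y)` does a path of the
test set have an occurrence of `y` after an occurrence of `x`. -/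
def RespectsNegative (G : CCFG V) (TS : Set (List V)) : Prop :=
  ∀ c ∈ G.C, ∀ p ∈ TS, ∀ p₁ p₂ p₃ : List V, p ≠ p₁ ++ [c.1] ++ p₂ ++ [c.2] ++ p₃

/-- The edge `e` occurs on the path `p`. -/
def Covers (p : List V) (e : V × V) : Prop :=
  [e.1, e.2] <:+: p

/-- `TS` is a test set that achieves edge coverage for `G` respecting the constraints of `G`,
taken as NEGATIVE constraints. -/
def AchievesECNegative (G : CCFG V) (TS : Set (List V)) : Prop :=
  G.IsTestSet TS ∧ G.RespectsNegative TS ∧ ∀ e ∈ G.E, ∃ p ∈ TS, Covers p e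

end CCFG

/-! ### The machine model

First-order recursive programs with call by value over binary trees whose leaves are `nil` or
atoms. The only operations are `cons`, `hd`, `tl`, the comparison of two atoms, branching on
`nil`, and calls of the finitely many functions of the program. There is no arithmetic on atoms
and no comparison of whole trees, so each step is a constant number of pointer operations and the
model is polynomially equivalent to Turing machines. -/

/-- The data: binary trees. A list is `cons first (cons second … nil)`. -/
inductive Tree : Type where
  | nil : Tree
  | atom (n : ℕ) : Tree
  | cons (a b : Tree) : Tree

namespace Tree

/-- The left subtree, `nil` if there is none. -/
def hd : Tree → Tree
  | cons a _ => a
  | _ => nil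

/-- The right subtree, `nil` if there is none. -/
def tl : Tree → Tree
  | cons _ b => b
  | _ => nil

/-- The truth value "true"; "false" is `nil`. -/
def tt : Tree := cons nil nil

/-- Comparison of atoms. It is "false" on anything else. -/
def eqAtom : Tree → Tree → Tree
  | atom m, atom n => if m = n then tt else nil
  | _, _ => nil

/-- The tree of a list of trees. -/
def ofList : List Tree → Tree
  | [] => nil
  | a :: l => cons a (ofList l)

end Tree

/-- Expressions over a type `F` of function names. The variable `var i` is the `i`-th parameter
(counted from `0`) of the function in whose body it stands. -/
inductive Exp (F : Type) : Type where
  | var (i : ℕ) : Exp F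
  | nil : Exp F
  | cons (e₁ e₂ : Exp F) : Exp F
  | hd (e : Exp F) : Exp F
  | tl (e : Exp F) : Exp F
  | eq (e₁ e₂ : Exp F) : Exp F
  | ite (e e₁ e₂ : Exp F) : Exp F
  | call (f : F) (args : List (Exp F)) : Exp F

/-- A program: finitely many function names, a body for each, and a main function, which is
called with the input as its only argument. -/
structure Program where
  /-- function names -/
  Fn : Type
  finite_fn : Finite Fn
  /-- the body of each function -/
  body : Fn → Exp Fn
  /-- the main function -/
  main : Fn

mutual

/-- `Eval P env e v t`: with parameter values `env` the expression `e` evaluates to `v`, and this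
takes exactly `t` steps, a step being the evaluation of one node of an expression. -/
inductive Eval (P : Program) : List Tree → Exp P.Fn → Tree → ℕ → Prop where
  | var (env : List Tree) (i : ℕ) : Eval P env (.var i) (env.getD i .nil) 1
  | nil (env : List Tree) : Eval P env .nil .nil 1
  | cons {env : List Tree} {e₁ e₂ : Exp P.Fn} {v₁ v₂ : Tree} {t₁ t₂ : ℕ} :
      Eval P env e₁ v₁ t₁ → Eval P env e₂ v₂ t₂ →
      Eval P env (.cons e₁ e₂) (.cons v₁ v₂) (t₁ + t₂ + 1)
  | hd {env : List Tree} {e : Exp P.Fn} {v : Tree} {t : ℕ} :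
      Eval P env e v t → Eval P env (.hd e) v.hd (t + 1)
  | tl {env : List Tree} {e : Exp P.Fn} {v : Tree} {t : ℕ} :
      Eval P env e v t → Eval P env (.tl e) v.tl (t + 1)
  | eq {env : List Tree} {e₁ e₂ : Exp P.Fn} {v₁ v₂ : Tree} {t₁ t₂ : ℕ} :
      Eval P env e₁ v₁ t₁ → Eval P env e₂ v₂ t₂ →
      Eval P env (.eq e₁ e₂) (Tree.eqAtom v₁ v₂) (t₁ + t₂ + 1)
  | ite_true {env : List Tree} {e e₁ e₂ : Exp P.Fn} {b v : Tree} {t t₁ : ℕ} :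
      Eval P env e b t → b ≠ .nil → Eval P env e₁ v t₁ →
      Eval P env (.ite e e₁ e₂) v (t + t₁ + 1)
  | ite_false {env : List Tree} {e e₁ e₂ : Exp P.Fn} {v : Tree} {t t₂ : ℕ} :
      Eval P env e .nil t → Eval P env e₂ v t₂ →
      Eval P env (.ite e e₁ e₂) v (t + t₂ + 1)
  | call {env vs : List Tree} {f : P.Fn} {es : List (Exp P.Fn)} {v : Tree} {t t' : ℕ} :
      EvalArgs P env es vs t → Eval P vs (P.body f) v t' →
      Eval P env (.call f es) v (t + t' + 1)

/-- The evaluation, one after the other, of the arguments of a call. -/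
inductive EvalArgs (P : Program) : List Tree → List (Exp P.Fn) → List Tree → ℕ → Prop where
  | nil (env : List Tree) : EvalArgs P env [] [] 0
  | cons {env vs : List Tree} {e : Exp P.Fn} {es : List (Exp P.Fn)} {v : Tree} {t t' : ℕ} :
      Eval P env e v t → EvalArgs P env es vs t' →
      EvalArgs P env (e :: es) (v :: vs) (t + t')

end

/-- On input `x` the program halts after at most `T` steps and its output is the truth value
of `A`. -/
def Program.DecidesWithin (P : Program) (x : Tree) (A : Prop) (T : ℕ) : Prop :=
  ∃ v t, Eval P [x] (P.body P.main) v t ∧ t ≤ T ∧ ((v = .tt ∧ A) ∨ (v = .nil ∧ ¬ A))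

/-! ### Parameterized problems -/

/-- A parameterized decision problem: instances with their encoding as data, their size, their
parameter, and the yes-instances. -/
structure ParamProblem where
  /-- instances -/
  Inst : Type
  /-- encoding of instances -/
  enc : Inst → Tree
  /-- size of instances -/
  size : Inst → ℕ
  /-- parameter of instances -/
  param : Inst → ℕ
  /-- yes-instances -/
  Yes : Inst → Prop

/-- `P` decides the problem in time `f(parameter) · p(size)` for a computable function `f` and a
polynomial `p`. -/
def Program.DecidesInFPTTime (P : Program) (Q : ParamProblem) : Prop :=
  ∃ (f : ℕ → ℕ) (p : Polynomial ℕ), Computable f ∧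
    ∀ I : Q.Inst, P.DecidesWithin (Q.enc I) (Q.Yes I) (f (Q.param I) * p.eval (Q.size I))

/-- A parameterized problem is fixed-parameter tractable. -/
def IsFPT (Q : ParamProblem) : Prop :=
  ∃ P : Program, P.DecidesInFPTTime Q

/-- A cCFG on the vertices `0, …, n - 1`, given by its list of edges and its list of constraints,
each in any order. -/
structure PresentedCCFG where
  /-- the number of vertices -/
  n : ℕ
  /-- the cCFG -/
  G : CCFG (Fin n)
  /-- the edges as a list -/
  edges : List (Fin n × Fin n)
  edges_nodup : edges.Nodup
  mem_edges : ∀ e, e ∈ edges ↔ e ∈ G.E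
  /-- the constraints as a list -/
  constraints : List (Fin n × Fin n)
  constraints_nodup : constraints.Nodup
  mem_constraints : ∀ c, c ∈ constraints ↔ c ∈ G.C

namespace PresentedCCFG

/-- A vertex as a tree. -/
def encVertex {n : ℕ} (v : Fin n) : Tree := .atom v

/-- A pair of vertices as a tree. -/
def encPair {n : ℕ} (e : Fin n × Fin n) : Tree := .cons (encVertex e.1) (encVertex e.2)

/-- The 5-tuple (list of vertices, list of edges, `s`, `t`, list of constraints) as a tree. -/
def enc (I : PresentedCCFG) : Tree :=
  .ofList [.ofList ((List.finRange I.n).map encVertex), .ofList (I.edges.map encPair),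
    encVertex I.G.s, encVertex I.G.t, .ofList (I.constraints.map encPair)]

end PresentedCCFG

/-- Edge coverage with NEGATIVE constraints, parameterized by the number of constraints: does a
test set exist that achieves edge coverage and respects the constraints? -/
def negativeEC : ParamProblem where
  Inst := PresentedCCFG
  enc I := I.enc
  size I := I.n + I.G.E.card
  param I := I.G.C.card
  Yes I := ∃ TS : Set (List (Fin I.n)), I.G.AchievesECNegative TS

/-! ### The algorithm

Sets and sequences are lists, an edge or a constraint is a pair `cons u v`, and the path under
construction is kept in reverse order, its last vertex being the head of the list; `nil` stands
for "no path". A graph `G` is the encoded 5-tuple. `Cᵛ` is the set of vertices that occur in a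
constraint. -/

/-- Names of the functions of the program. -/
inductive Fn : Type where
  | mem | insert | append | orElse
  | critical
  | consAll | insertions | extendAll | sequences
  | before | admissible
  | onPath | minusPath | covered | uncovered
  | blocked | available | allowed
  | findEnd | relax | closure | endAt | plainTo | continueTo | throughTo | segment
  | initOk | findProperPath | walk | finish
  | whileEdges | update | forSequences | hasEdgeCoverage

theorem finite_Fn : Finite Fn := by
  let all : List Fn := [.mem, .insert, .append, .orElse, .critical, .consAll, .insertions,
    .extendAll, .sequences, .before, .admissible, .onPath, .minusPath, .covered, .uncovered,
    .blocked, .available, .allowed, .findEnd, .relax, .closure, .endAt, .plainTo, .continueTo,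
    .throughTo, .segment, .initOk, .findProperPath, .walk, .finish, .whileEdges, .update,
    .forSequences, .hasEdgeCoverage]
  have h : ∀ f : Fn, f ∈ all := by
    intro f
    cases f <;> simp [all]
  exact Set.finite_univ_iff.mp (all.finite_toSet.subset fun f _ => h f)

namespace Exp

/-- The vertex list of an encoded graph. -/
def gV {F : Type} (g : Exp F) : Exp F := hd g
/-- The edge list of an encoded graph. -/
def gE {F : Type} (g : Exp F) : Exp F := hd (tl g)
/-- The source of an encoded graph. -/
def gs {F : Type} (g : Exp F) : Exp F := hd (tl (tl g))
/-- The sink of an encoded graph. -/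
def gt {F : Type} (g : Exp F) : Exp F := hd (tl (tl (tl g)))
/-- The constraint list of an encoded graph. -/
def gC {F : Type} (g : Exp F) : Exp F := hd (tl (tl (tl (tl g))))
/-- The truth value "true". -/
def tt {F : Type} : Exp F := cons nil nil

end Exp

open Exp in
/-- The bodies of the functions. -/
def algorithmBody : Fn → Exp Fn
  -- Lists.
  -- `mem x L`: is the atom `x` in `L`?
  | .mem =>
    let x := var 0; let L := var 1
    ite L (ite (eq x (hd L)) tt (call .mem [x, tl L])) nil
  -- `insert x L`: add the atom `x` to `L` unless it is there.
  | .insert =>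
    let x := var 0; let L := var 1
    ite (call .mem [x, L]) L (cons x L)
  | .append =>
    let K := var 0; let L := var 1
    ite K (cons (hd K) (call .append [tl K, L])) L
  -- `orElse a b`: `a`, or `b` if `a` is `nil`.
  | .orElse =>
    let a := var 0; let b := var 1
    ite a a b
  -- `critical C`: the set `Cᵛ`.
  | .critical =>
    let C := var 0
    ite C
      (call .insert [hd (hd C), call .insert [tl (hd C), call .critical [tl C]]])
      nil
  -- Enumeration of the sequences of distinct elements of a set.
  -- `consAll a D`: put `a` in front of every sequence in `D`.
  | .consAll =>
    let a := var 0; let D := var 1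
    ite D (cons (cons a (hd D)) (call .consAll [a, tl D])) nil
  -- `insertions x d`: all results of inserting `x` into the sequence `d`.
  | .insertions =>
    let x := var 0; let d := var 1
    cons (cons x d)
      (ite d (call .consAll [hd d, call .insertions [x, tl d]]) nil)
  -- `extendAll x D`: every sequence in `D`, without `x` and with `x` inserted anywhere.
  | .extendAll =>
    let x := var 0; let D := var 1
    ite D
      (cons (hd D)
        (call .append [call .insertions [x, hd D], call .extendAll [x, tl D]]))
      nil
  -- `sequences L`: all sequences over `L` in which every element appears at most once.
  | .sequences =>
    let L := var 0
    ite L (call .extendAll [hd L, call .sequences [tl L]]) (cons nil nil)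
  -- `before y x c`: does `y` occur in `c` with `x` after it?
  | .before =>
    let y := var 0; let x := var 1; let c := var 2
    ite c
      (ite (eq y (hd c)) (call .mem [x, tl c]) (call .before [y, x, tl c]))
      nil
  -- `admissible C c`: for all `(x, y)` in `C` with `x ≠ y` and both `x` and `y` in `c`,
  -- the vertex `y` stands before `x` in `c`.
  | .admissible =>
    let C := var 0; let c := var 1
    let x := hd (hd C); let y := tl (hd C)
    let rest := call .admissible [tl C, c]
    ite C
      (ite (eq x y) rest
        (ite (call .mem [x, c])
          (ite (call .mem [y, c]) (ite (call .before [y, x, c]) rest nil) rest)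
          rest))
      tt
  -- Edges on paths.
  -- `onPath u v p`: does the reversed path `p` contain the edge `(u, v)`?
  | .onPath =>
    let u := var 0; let v := var 1; let p := var 2
    ite p
      (ite (tl p)
        (ite (ite (eq v (hd p)) (eq u (hd (tl p))) nil) tt
          (call .onPath [u, v, tl p]))
        nil)
      nil
  -- `minusPath E p`: the edges in `E` that are not on `p`.
  | .minusPath =>
    let E := var 0; let p := var 1
    let rest := call .minusPath [tl E, p]
    ite E
      (ite (call .onPath [hd (hd E), tl (hd E), p]) rest (cons (hd E) rest))
      nil
  -- `covered u v T`: is the edge `(u, v)` on some path in `T`?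
  | .covered =>
    let u := var 0; let v := var 1; let T := var 2
    ite T (ite (call .onPath [u, v, hd T]) tt (call .covered [u, v, tl T])) nil
  -- `uncovered E T`: the edges in `E` that are on no path in `T`.
  | .uncovered =>
    let E := var 0; let T := var 1
    let rest := call .uncovered [tl E, T]
    ite E
      (ite (call .covered [hd (hd E), tl (hd E), T]) rest (cons (hd E) rest))
      nil
  -- The vertex set of the graph `G'`, where `r` is the part of `c` not yet reached:
  -- all vertices outside `Cᵛ`, and all `x` in `r` for which no `(x, y)` in `C` has `y` in `r`.
  -- `blocked C x r`: is there `(x, y)` in `C` with `y` in `r`?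
  | .blocked =>
    let C := var 0; let x := var 1; let r := var 2
    let rest := call .blocked [tl C, x, r]
    ite C
      (ite (eq x (hd (hd C))) (ite (call .mem [tl (hd C), r]) tt rest) rest)
      nil
  -- `available C x r`: is `x` a vertex of `G'`?
  | .available =>
    let C := var 0; let x := var 1; let r := var 2
    ite (call .mem [x, call .critical [C]])
      (ite (call .mem [x, r]) (ite (call .blocked [C, x, r]) nil tt) nil)
      tt
  -- `allowed L C r`: the vertices of `G'` that are in `L`.
  | .allowed =>
    let L := var 0; let C := var 1; let r := var 2
    let rest := call .allowed [tl L, C, r]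
    ite L (ite (call .available [C, hd L, r]) (cons (hd L) rest) rest) nil
  -- Search for paths. `A` is the vertex set of `G'`, `P` is a list of reversed paths.
  -- `findEnd x P`: a path in `P` that ends in `x`.
  | .findEnd =>
    let x := var 0; let P := var 1
    ite P (ite (eq x (hd (hd P))) (hd P) (call .findEnd [x, tl P])) nil
  -- `relax E A P`: for each edge `(x, y)` in `E` with `y` in `A`, if some path in `P` ends in
  -- `x` and none in `y`, add the extended path to `P`.
  | .relax =>
    let E := var 0; let A := var 1; let P := var 2
    let x := hd (hd E); let y := tl (hd E)
    ite E
      (ite (call .mem [y, A])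
        (ite (call .findEnd [y, P])
          (call .relax [tl E, A, P])
          (ite (call .findEnd [x, P])
            (call .relax [tl E, A, cons (cons y (call .findEnd [x, P])) P])
            (call .relax [tl E, A, P])))
        (call .relax [tl E, A, P]))
      P
  -- `closure L E A P`: as many rounds of `relax` as `L` has elements.
  | .closure =>
    let L := var 0; let E := var 1; let A := var 2; let P := var 3
    ite L (call .closure [tl L, E, A, call .relax [E, A, P]]) P
  -- `endAt y E P`: a path in `P` that ends in a vertex `x` with `(x, y)` in `E`, extended by `y`.
  | .endAt =>
    let y := var 0; let E := var 1; let P := var 2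
    ite E
      (ite (ite (eq y (tl (hd E))) (call .findEnd [hd (hd E), P]) nil)
        (cons y (call .findEnd [hd (hd E), P]))
        (call .endAt [y, tl E, P]))
      nil
  -- `plainTo G A p y`: the path `p`, extended to a path that ends in `y`, where all new vertices
  -- but the last one are in `A`; `p` itself if it already ends in `y`.
  | .plainTo =>
    let G := var 0; let A := var 1; let p := var 2; let y := var 3
    let P := call .closure [gV G, gE G, A, cons p nil]
    call .orElse [call .findEnd [y, P], call .endAt [y, gE G, P]]
  -- `continueTo G A q v y`: the path `q` extended by the vertex `v`, and then to `y`.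
  | .continueTo =>
    let G := var 0; let A := var 1; let q := var 2; let v := var 3; let y := var 4
    ite q
      (ite (ite (eq v y) tt (call .mem [v, A]))
        (call .plainTo [G, A, cons v q, y])
        nil)
      nil
  -- `throughTo G A p u v y`: as `plainTo`, but the new part contains the edge `(u, v)`.
  | .throughTo =>
    let G := var 0; let A := var 1; let p := var 2
    let u := var 3; let v := var 4; let y := var 5
    call .continueTo
      [G, A, call .findEnd [u, call .closure [gV G, gE G, A, cons p nil]], v, y]
  -- `segment G A p u v y`: extend `p` to `y`, through `(u, v)` if `p` does not yet contain this
  -- edge and this is possible.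
  | .segment =>
    let G := var 0; let A := var 1; let p := var 2
    let u := var 3; let v := var 4; let y := var 5
    ite (call .onPath [u, v, p])
      (call .plainTo [G, A, p, y])
      (call .orElse [call .throughTo [G, A, p, u, v, y], call .plainTo [G, A, p, y]])
  -- `initOk x C c`: is `x` outside `Cᵛ` or in `c`?
  | .initOk =>
    let x := var 0; let C := var 1; let c := var 2
    ite (call .mem [x, call .critical [C]]) (call .mem [x, c]) tt
  -- `findProperPath G c u v`: a `c`-proper path from `s` to `t` that contains `(u, v)`.
  | .findProperPath =>
    let G := var 0; let c := var 1; let u := var 2; let v := var 3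
    ite (call .initOk [gs G, gC G, c])
      (ite (call .initOk [gt G, gC G, c])
        (call .walk [G, c, cons (gs G) nil, u, v])
        nil)
      nil
  -- `walk G r p u v`: the loop over the elements of `c`; `r` is what is left of `c`.
  | .walk =>
    let G := var 0; let r := var 1; let p := var 2; let u := var 3; let v := var 4
    let A := call .allowed [gV G, gC G, r]
    ite p
      (ite r
        (call .walk [G, tl r, call .segment [G, A, p, u, v, hd r], u, v])
        (call .finish [G, A, p, u, v]))
      nil
  -- `finish G A p u v`: the last part of the path, to `t`.
  | .finish =>
    let G := var 0; let A := var 1; let p := var 2; let u := var 3; let v := var 4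
    ite (call .onPath [u, v, p])
      (call .plainTo [G, A, p, gt G])
      (call .throughTo [G, A, p, u, v, gt G])
  -- The main loops.
  -- `whileEdges G c E' T`: while `E'` is not empty, take an edge from it and look for a path.
  | .whileEdges =>
    let G := var 0; let c := var 1; let E' := var 2; let T := var 3
    ite E'
      (call .update
        [G, c, E', T, call .findProperPath [G, c, hd (hd E'), tl (hd E')]])
      T
  -- `update G c E' T p`: use the path `p` that was found for the first edge in `E'`.
  | .update =>
    let G := var 0; let c := var 1; let E' := var 2; let T := var 3; let p := var 4
    ite p
      (call .whileEdges [G, c, call .minusPath [E', p], cons p T])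
      (call .whileEdges [G, c, tl E', T])
  -- `forSequences G S T`: the loop over the sequences in `S`, of which only the admissible ones
  -- are used; then the test whether `T` covers every edge.
  | .forSequences =>
    let G := var 0; let S := var 1; let T := var 2
    ite S
      (ite (call .admissible [gC G, hd S])
        (call .forSequences
          [G, tl S, call .whileEdges [G, hd S, call .uncovered [gE G, T], T]])
        (call .forSequences [G, tl S, T]))
      (ite (call .uncovered [gE G, T]) nil tt)
  | .hasEdgeCoverage =>
    let G := var 0
    call .forSequences [G, call .sequences [call .critical [gC G]], nil]

/-- The algorithm HasEdgeCoverageWithNegative. -/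
def hasEdgeCoverageWithNegative : Program where
  Fn := Fn
  finite_fn := finite_Fn
  body := algorithmBody
  main := .hasEdgeCoverage

end CFGTest

/-!
The algorithm is correct because it considers one segment of a path at a time. Let `π` be a test
path that respects the constraints, and order the vertices on `π` that occur in constraints by
their last occurrences on `π`. The sequence `c` obtained is admissible, and between two consecutive
last occurrences `π` visits, besides unconstrained vertices, only vertices that occur again later
on and are therefore not blocked. So every segment is a walk in the graph in which FindProperPath
searches. Since the ends of the segments are determined by `c`, the choice of one segment does not
influence the others, and it is enough to cover a given edge of `π` in the first segment in which
this is possible (`walk_ne_nil`, `exists_properPath_ne_nil`). Conversely, every path that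
FindProperPath returns respects the constraints: for no constraint `(x, y)` can `y` be visited
after `x`, because `y` would have to be in the part of `c` not yet reached when `x` is visited, and
then `x` would be blocked as an inner vertex, and as an element of `c` it would stand before `y` in
spite of the order (`walk_sound`, `properPath_sound`). The search itself is a closure process which
gains a vertex in each round until it is saturated (`isClosedUnder_closureList`).

Paths are handled in reversed form, as in the program, so a constraint `(x, y)` is violated by the
reversed path `q` if `[y, x]` is a sublist of `q`, and `q` contains the edge `(u, v)` if `[v, u]`
is an infix of `q`.

For the program, each function is paired with a function on Lean lists and with a bound for the
number of its steps (the lemmas `run_…`), obtained by a calculus of weakest preconditions in which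
a call is replaced by what is known about the function called (`Runs.bind`). Apart from short loops
over a single list, the bounds are of the form `a * M ^ b`, where `M` bounds the lengths of all
lists that appear. One can take `M` to be `10 * (2 k + 2)! * (N + 1) ^ 2` for `k` constraints and
`N` vertices and edges, since there are at most `(2 k + 1)!` sequences (`length_sequencesList_le`).
The total `10000 * M ^ 6` is the product of a computable function of `k` and a polynomial in `N`.
-/

namespace CFGTest

/-! ### Weakest preconditions for programs -/

/-- The weakest precondition: with parameter values `env` the expression `e` evaluates, and its
value and the number of steps satisfy `Q`. -/
def Program.Wp (P : Program) (env : List Tree) (e : Exp P.Fn) (Q : Tree → ℕ → Prop) : Prop :=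
  ∃ v t, Eval P env e v t ∧ Q v t

/-- The weakest precondition for the evaluation of a list of arguments. -/
def Program.WpArgs (P : Program) (env : List Tree) (es : List (Exp P.Fn))
    (Q : List Tree → ℕ → Prop) : Prop :=
  ∃ vs t, EvalArgs P env es vs t ∧ Q vs t

namespace Program

variable {P : Program} {env : List Tree} {Q : Tree → ℕ → Prop} {e e₁ e₂ : Exp P.Fn}

theorem wp_var {i : ℕ} : P.Wp env (.var i) Q ↔ Q (env.getD i .nil) 1 := by
  constructor
  · rintro ⟨v, t, h, hQ⟩
    cases h
    exact hQ
  · exact fun h => ⟨_, _, .var _ _, h⟩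

theorem wp_nil : P.Wp env .nil Q ↔ Q .nil 1 := by
  constructor
  · rintro ⟨v, t, h, hQ⟩
    cases h
    exact hQ
  · exact fun h => ⟨_, _, .nil _, h⟩

theorem wp_cons : P.Wp env (.cons e₁ e₂) Q ↔
    P.Wp env e₁ fun v₁ t₁ => P.Wp env e₂ fun v₂ t₂ => Q (.cons v₁ v₂) (t₁ + t₂ + 1) := by
  constructor
  · rintro ⟨v, t, h, hQ⟩
    cases h with
    | cons h₁ h₂ => exact ⟨_, _, h₁, _, _, h₂, hQ⟩
  · rintro ⟨_, _, h₁, _, _, h₂, hQ⟩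
    exact ⟨_, _, .cons h₁ h₂, hQ⟩

theorem wp_hd : P.Wp env (.hd e) Q ↔ P.Wp env e fun v t => Q v.hd (t + 1) := by
  constructor
  · rintro ⟨v, t, h, hQ⟩
    cases h with
    | hd h => exact ⟨_, _, h, hQ⟩
  · rintro ⟨_, _, h, hQ⟩
    exact ⟨_, _, .hd h, hQ⟩

theorem wp_tl : P.Wp env (.tl e) Q ↔ P.Wp env e fun v t => Q v.tl (t + 1) := by
  constructor
  · rintro ⟨v, t, h, hQ⟩
    cases h with
    | tl h => exact ⟨_, _, h, hQ⟩
  · rintro ⟨_, _, h, hQ⟩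
    exact ⟨_, _, .tl h, hQ⟩

theorem wp_eq : P.Wp env (.eq e₁ e₂) Q ↔
    P.Wp env e₁ fun v₁ t₁ => P.Wp env e₂ fun v₂ t₂ => Q (Tree.eqAtom v₁ v₂) (t₁ + t₂ + 1) := by
  constructor
  · rintro ⟨v, t, h, hQ⟩
    cases h with
    | eq h₁ h₂ => exact ⟨_, _, h₁, _, _, h₂, hQ⟩
  · rintro ⟨_, _, h₁, _, _, h₂, hQ⟩
    exact ⟨_, _, .eq h₁ h₂, hQ⟩

theorem wp_ite : P.Wp env (.ite e e₁ e₂) Q ↔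
    P.Wp env e fun b t => (b ≠ .nil → P.Wp env e₁ fun v t₁ => Q v (t + t₁ + 1)) ∧
      (b = .nil → P.Wp env e₂ fun v t₂ => Q v (t + t₂ + 1)) := by
  constructor
  · rintro ⟨v, t, h, hQ⟩
    cases h with
    | ite_true h hb h₁ => exact ⟨_, _, h, fun _ => ⟨_, _, h₁, hQ⟩, fun h => absurd h hb⟩
    | ite_false h h₂ => exact ⟨_, _, h, fun h => absurd rfl h, fun _ => ⟨_, _, h₂, hQ⟩⟩
  · rintro ⟨b, _, h, h₁, h₂⟩
    by_cases hb : b = .nil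
    · obtain ⟨_, _, h', hQ⟩ := h₂ hb
      subst hb
      exact ⟨_, _, .ite_false h h', hQ⟩
    · obtain ⟨_, _, h', hQ⟩ := h₁ hb
      exact ⟨_, _, .ite_true h hb h', hQ⟩

theorem wp_call {f : P.Fn} {es : List (Exp P.Fn)} : P.Wp env (.call f es) Q ↔
    P.WpArgs env es fun vs t => P.Wp vs (P.body f) fun v t' => Q v (t + t' + 1) := by
  constructor
  · rintro ⟨v, t, h, hQ⟩
    cases h with
    | call h₁ h₂ => exact ⟨_, _, h₁, _, _, h₂, hQ⟩
  · rintro ⟨_, _, h₁, _, _, h₂, hQ⟩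
    exact ⟨_, _, .call h₁ h₂, hQ⟩

theorem wpArgs_nil {Q : List Tree → ℕ → Prop} : P.WpArgs env [] Q ↔ Q [] 0 := by
  constructor
  · rintro ⟨v, t, h, hQ⟩
    cases h
    exact hQ
  · exact fun h => ⟨_, _, .nil _, h⟩

theorem wpArgs_cons {es : List (Exp P.Fn)} {Q : List Tree → ℕ → Prop} :
    P.WpArgs env (e :: es) Q ↔
      P.Wp env e fun v t => P.WpArgs env es fun vs t' => Q (v :: vs) (t + t') := by
  constructor
  · rintro ⟨v, t, h, hQ⟩
    cases h with
    | cons h₁ h₂ => exact ⟨_, _, h₁, _, _, h₂, hQ⟩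
  · rintro ⟨_, _, h₁, _, _, h₂, hQ⟩
    exact ⟨_, _, .cons h₁ h₂, hQ⟩

end Program

/-- `Program.Wp` for the program `hasEdgeCoverageWithNegative`. -/
def Wp (env : List Tree) (e : Exp Fn) (Q : Tree → ℕ → Prop) : Prop :=
  hasEdgeCoverageWithNegative.Wp env e Q

/-- `Program.WpArgs` for the program `hasEdgeCoverageWithNegative`. -/
def WpArgs (env : List Tree) (es : List (Exp Fn)) (Q : List Tree → ℕ → Prop) : Prop :=
  hasEdgeCoverageWithNegative.WpArgs env es Q

/-- The weakest precondition of a call of `f` with the arguments `vs`. It is a definition of its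
own so that the body of `f` is not unfolded where `f` is called. -/
def WpCall (f : Fn) (vs : List Tree) (Q : Tree → ℕ → Prop) : Prop :=
  Wp vs (algorithmBody f) Q

/-- The function `f` with the arguments `vs` returns `v` after at most `T` steps. -/
def Runs (f : Fn) (vs : List Tree) (v : Tree) (T : ℕ) : Prop :=
  WpCall f vs fun v' t => v' = v ∧ t ≤ T

theorem runs_iff {f : Fn} {vs : List Tree} {v : Tree} {T : ℕ} :
    Runs f vs v T ↔ Wp vs (algorithmBody f) fun v' t => v' = v ∧ t ≤ T :=
  Iff.rfl

section
variable {env : List Tree} {Q : Tree → ℕ → Prop} {e e₁ e₂ : Exp Fn}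

@[simp] theorem wp_var {i : ℕ} : Wp env (.var i) Q ↔ Q (env.getD i .nil) 1 :=
  Program.wp_var

@[simp] theorem wp_nil : Wp env .nil Q ↔ Q .nil 1 :=
  Program.wp_nil

@[simp] theorem wp_cons : Wp env (.cons e₁ e₂) Q ↔
    Wp env e₁ fun v₁ t₁ => Wp env e₂ fun v₂ t₂ => Q (.cons v₁ v₂) (t₁ + t₂ + 1) :=
  Program.wp_cons

@[simp] theorem wp_hd : Wp env (.hd e) Q ↔ Wp env e fun v t => Q v.hd (t + 1) :=
  Program.wp_hd

@[simp] theorem wp_tl : Wp env (.tl e) Q ↔ Wp env e fun v t => Q v.tl (t + 1) :=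
  Program.wp_tl

@[simp] theorem wp_eq : Wp env (.eq e₁ e₂) Q ↔
    Wp env e₁ fun v₁ t₁ => Wp env e₂ fun v₂ t₂ => Q (Tree.eqAtom v₁ v₂) (t₁ + t₂ + 1) :=
  Program.wp_eq

@[simp] theorem wp_ite : Wp env (.ite e e₁ e₂) Q ↔
    Wp env e fun b t => (b ≠ .nil → Wp env e₁ fun v t₁ => Q v (t + t₁ + 1)) ∧
      (b = .nil → Wp env e₂ fun v t₂ => Q v (t + t₂ + 1)) :=
  Program.wp_ite

@[simp] theorem wp_call {f : Fn} {es : List (Exp Fn)} : Wp env (.call f es) Q ↔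
    WpArgs env es fun vs t => WpCall f vs fun v t' => Q v (t + t' + 1) :=
  Program.wp_call

@[simp] theorem wpArgs_nil {Q : List Tree → ℕ → Prop} : WpArgs env [] Q ↔ Q [] 0 :=
  Program.wpArgs_nil

@[simp] theorem wpArgs_cons {es : List (Exp Fn)} {Q : List Tree → ℕ → Prop} :
    WpArgs env (e :: es) Q ↔
      Wp env e fun v t => WpArgs env es fun vs t' => Q (v :: vs) (t + t') :=
  Program.wpArgs_cons

end

/-- A call may be replaced by its result: what is to be shown after the call need only be shown for
the value `v` and every number of steps up to `T`. -/
theorem Runs.bind {f : Fn} {vs : List Tree} {v : Tree} {T : ℕ} {Q : Tree → ℕ → Prop}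
    (h : Runs f vs v T) (hQ : ∀ t ≤ T, Q v t) : WpCall f vs Q := by
  obtain ⟨v, t, h, rfl, ht⟩ := h
  exact ⟨_, _, h, hQ t ht⟩

theorem Runs.mono {f : Fn} {vs : List Tree} {v : Tree} {T T' : ℕ} (h : Runs f vs v T)
    (hT : T ≤ T') : Runs f vs v T' :=
  h.bind fun _ ht => ⟨rfl, ht.trans hT⟩

/-! ### Encoded lists -/

open PresentedCCFG

variable {n : ℕ}

/-- A list of vertices as a tree. -/
def encL (L : List (Fin n)) : Tree := .ofList (L.map encVertex)

/-- A list of pairs of vertices as a tree. -/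
def encE (E : List (Fin n × Fin n)) : Tree := .ofList (E.map encPair)

/-- A list of lists of vertices as a tree. -/
def encP (P : List (List (Fin n))) : Tree := .ofList (P.map encL)

/-- A truth value as a tree. -/
def encB (b : Bool) : Tree := if b then .tt else .nil

@[simp] theorem encL_nil : encL ([] : List (Fin n)) = .nil := rfl
@[simp] theorem encL_cons (a : Fin n) (L) : encL (a :: L) = .cons (.atom a) (encL L) := rfl
@[simp] theorem encE_nil : encE ([] : List (Fin n × Fin n)) = .nil := rfl
@[simp] theorem encE_cons (a : Fin n × Fin n) (L) :
    encE (a :: L) = .cons (.cons (.atom a.1) (.atom a.2)) (encE L) := rfl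
@[simp] theorem encP_nil : encP ([] : List (List (Fin n))) = .nil := rfl
@[simp] theorem encP_cons (a : List (Fin n)) (L) :
    encP (a :: L) = .cons (encL a) (encP L) := rfl
@[simp] theorem encB_true : encB true = .cons .nil .nil := rfl
@[simp] theorem encB_false : encB false = .nil := rfl

@[simp] theorem hd_nil : Tree.nil.hd = .nil := rfl
@[simp] theorem hd_cons (a b : Tree) : (Tree.cons a b).hd = a := rfl
@[simp] theorem tl_nil : Tree.nil.tl = .nil := rfl
@[simp] theorem tl_cons (a b : Tree) : (Tree.cons a b).tl = b := rfl

@[simp] theorem encB_eq_nil {b : Bool} : encB b = .nil ↔ b = false := by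
  cases b <;> simp

@[simp] theorem encL_eq_nil {L : List (Fin n)} : encL L = .nil ↔ L = [] := by
  cases L <;> simp

@[simp] theorem eqAtom_nil (m : ℕ) : Tree.eqAtom (.atom m) .nil = .nil := rfl

@[simp] theorem eqAtom_atom (v w : Fin n) :
    Tree.eqAtom (.atom v) (.atom w) = encB (decide (v = w)) := by
  by_cases h : v = w <;> simp [Tree.eqAtom, Tree.tt, Fin.val_inj, h]

/-- Turns the bound `(l + 1) * B` that an induction gives for a loop over a list of length `l` into
a bound in terms of `M` alone. -/
theorem loop_le {l M : ℕ} (h : l < M) (B : ℕ) : (l + 1) * B ≤ M * B :=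
  Nat.mul_le_mul_right B h

theorem pow_chain {M : ℕ} (hM : 1 ≤ M) :
    M ≤ M ^ 2 ∧ M ^ 2 ≤ M ^ 3 ∧ M ^ 3 ≤ M ^ 4 ∧ M ^ 4 ≤ M ^ 5 :=
  ⟨Nat.le_self_pow two_ne_zero M, Nat.pow_le_pow_right hM (by norm_num),
    Nat.pow_le_pow_right hM (by norm_num), Nat.pow_le_pow_right hM (by norm_num)⟩

theorem run_mem (x : Fin n) (L : List (Fin n)) :
    Runs .mem [.atom x, encL L] (encB (decide (x ∈ L))) (20 * (L.length + 1)) := by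
  induction L with
  | nil => simp [runs_iff, algorithmBody]
  | cons a L ih =>
    simp only [runs_iff, algorithmBody]
    simp
    refine ⟨fun h => ?_, fun h => ih.bind fun t ht => ?_⟩
    · simp [Exp.tt, h]
      omega
    · simp [h]
      omega

/-! ### Operations on lists -/

section
variable {V : Type} [DecidableEq V]

/-- The set `Cᵛ` as a list without repetitions. -/
def criticalList : List (V × V) → List V
  | [] => []
  | c :: C => ((criticalList C).insert c.2).insert c.1

/-- All results of inserting `x` into the sequence `d`. -/
def insertionsList (x : V) : List V → List (List V)
  | [] => [[x]]
  | a :: d => (x :: a :: d) :: (insertionsList x d).map (a :: ·)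

/-- Every sequence in `D`, without `x` and with `x` inserted anywhere. -/
def extendAllList (x : V) : List (List V) → List (List V)
  | [] => []
  | d :: D => d :: (insertionsList x d ++ extendAllList x D)

/-- All sequences over `L` in which every element appears at most once. -/
def sequencesList : List V → List (List V)
  | [] => [[]]
  | x :: L => extendAllList x (sequencesList L)

/-- For all `(x, y)` in `C` with `x ≠ y` and both `x` and `y` in `c`, the vertex `y` stands before
`x` in `c`. -/
def Admissible (C : List (V × V)) (c : List V) : Prop :=
  ∀ e ∈ C, e.1 ≠ e.2 → e.1 ∈ c → e.2 ∈ c → [e.2, e.1].Sublist c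

instance (C : List (V × V)) (c : List V) : Decidable (Admissible C c) := by
  unfold Admissible
  infer_instance

/-- The edges in `E` that are not on the reversed path `p`. -/
def minusPathList (E : List (V × V)) (p : List V) : List (V × V) :=
  E.filter fun e => ¬ [e.2, e.1] <:+: p

/-- The edges in `E` that are on no reversed path in `T`. -/
def uncoveredList (E : List (V × V)) (T : List (List V)) : List (V × V) :=
  E.filter fun e => ¬ ∃ p ∈ T, [e.2, e.1] <:+: p

/-- Some constraint `(x, y)` has `y` in `r`. -/
def Blocked (C : List (V × V)) (x : V) (r : List V) : Prop :=
  ∃ e ∈ C, e.1 = x ∧ e.2 ∈ r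

instance (C : List (V × V)) (x : V) (r : List V) : Decidable (Blocked C x r) := by
  unfold Blocked
  infer_instance

/-- `x` may be an inner vertex of the segment during which `r` is the part of the sequence not
yet reached. -/
def Available (C : List (V × V)) (x : V) (r : List V) : Prop :=
  x ∈ criticalList C → x ∈ r ∧ ¬ Blocked C x r

instance (C : List (V × V)) (x : V) (r : List V) : Decidable (Available C x r) := by
  unfold Available
  infer_instance

/-- A path in `P` that ends in `x`, or `[]` if there is none. Paths are reversed, so that the last
vertex of a path is the head of the list. -/
def findEndList (x : V) : List (List V) → List V
  | [] => []
  | p :: P => if p.head? = some x then p else findEndList x P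

/-- One round of the search: for each edge `(x, y)` in `E` with `y` in `A`, if some path in `P`
ends in `x` and none in `y`, the path extended by `y` is added. -/
def relaxList (A : List V) : List (V × V) → List (List V) → List (List V)
  | [], P => P
  | e :: E, P =>
    if e.2 ∈ A ∧ findEndList e.2 P = [] ∧ findEndList e.1 P ≠ [] then
      relaxList A E ((e.2 :: findEndList e.1 P) :: P)
    else relaxList A E P

/-- A path in `P` that ends in a vertex `x` with `(x, y)` in `E`, extended by `y`, or `[]` if there
is none. -/
def endAtList (y : V) (P : List (List V)) : List (V × V) → List V
  | [] => []
  | e :: E =>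
    if y = e.2 ∧ findEndList e.1 P ≠ [] then y :: findEndList e.1 P else endAtList y P E

theorem length_insert_le (a : V) (L : List V) : (L.insert a).length ≤ L.length + 1 := by
  rw [List.length_insert]
  split <;> omega

theorem length_criticalList_le (C : List (V × V)) : (criticalList C).length ≤ 2 * C.length := by
  induction C with
  | nil => simp [criticalList]
  | cons c C ih =>
    have h₁ := length_insert_le c.2 (criticalList C)
    have h₂ := length_insert_le c.1 ((criticalList C).insert c.2)
    simp only [criticalList, List.length_cons]
    omega

theorem length_insertionsList {W : Type} (x : W) (d : List W) :
    (insertionsList x d).length = d.length + 1 := by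
  induction d with
  | nil => rfl
  | cons a d ih => simp [insertionsList, ih]

theorem length_relaxList_le (A : List V) (E : List (V × V)) (P : List (List V)) :
    (relaxList A E P).length ≤ P.length + E.length := by
  induction E generalizing P with
  | nil => simp [relaxList]
  | cons e E ih =>
    rw [relaxList]
    split
    · have := ih ((e.2 :: findEndList e.1 P) :: P)
      simp only [List.length_cons] at this ⊢
      omega
    · have := ih P
      simp only [List.length_cons]
      omega

end

variable {M : ℕ}

theorem run_insert (x : Fin n) (L : List (Fin n)) :
    Runs .insert [.atom x, encL L] (encL (L.insert x)) (20 * (L.length + 1) + 10) := by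
  simp only [runs_iff, algorithmBody]
  simp
  refine (run_mem x L).bind fun t ht => ?_
  simp
  refine ⟨fun h => ?_, fun h => ?_⟩
  all_goals
    simp [h]
    omega

theorem run_append (K L : List (List (Fin n))) :
    Runs .append [encP K, encP L] (encP (K ++ L)) (20 * (K.length + 1)) := by
  induction K with
  | nil => simp [runs_iff, algorithmBody]
  | cons a K ih =>
    simp only [runs_iff, algorithmBody]
    simp
    refine ih.bind fun t ht => ?_
    simp
    omega

theorem run_orElse (p q : List (Fin n)) :
    Runs .orElse [encL p, encL q] (encL (if p = [] then q else p)) 10 := by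
  simp only [runs_iff, algorithmBody]
  simp
  constructor <;> intro h <;> simp [h]

theorem run_critical (C : List (Fin n × Fin n)) (hM : 1 ≤ M) (hC : 2 * C.length < M) :
    Runs .critical [encE C] (encL (criticalList C)) (100 * M ^ 2) := by
  suffices h : ∀ C : List (Fin n × Fin n), 2 * C.length < M →
      Runs .critical [encE C] (encL (criticalList C)) ((C.length + 1) * (100 * M)) from
    (h C hC).mono ((loop_le (l := C.length) (M := M) (by omega) _).trans_eq (by ring))
  intro C hC
  induction C with
  | nil =>
    simp [runs_iff, algorithmBody, criticalList]
    omega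
  | cons c C ih =>
    simp only [List.length_cons] at hC
    have h₁ := length_criticalList_le C
    have h₂ := length_insert_le c.2 (criticalList C)
    simp only [runs_iff, algorithmBody]
    simp
    refine (ih (by omega)).bind fun t ht => ?_
    refine (run_insert _ _).bind fun t₁ ht₁ => ?_
    refine (run_insert _ _).bind fun t₂ ht₂ => ?_
    simp only [criticalList, true_and]
    linarith

theorem run_consAll (a : Fin n) (D : List (List (Fin n))) :
    Runs .consAll [.atom a, encP D] (encP (D.map (a :: ·))) (20 * (D.length + 1)) := by
  induction D with
  | nil => simp [runs_iff, algorithmBody]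
  | cons d D ih =>
    simp only [runs_iff, algorithmBody]
    simp
    refine ih.bind fun t ht => ?_
    simp
    omega

theorem run_insertions (x : Fin n) (d : List (Fin n)) (hd : d.length < M) :
    Runs .insertions [.atom x, encL d] (encP (insertionsList x d)) (40 * M ^ 2) := by
  suffices h : ∀ d : List (Fin n), d.length < M →
      Runs .insertions [.atom x, encL d] (encP (insertionsList x d))
        ((d.length + 1) * (40 * M)) from
    (h d hd).mono ((loop_le hd _).trans_eq (by ring))
  intro d hd
  induction d with
  | nil =>
    simp [runs_iff, algorithmBody, insertionsList]
    omega
  | cons a d ih =>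
    simp only [List.length_cons] at hd
    simp only [runs_iff, algorithmBody]
    simp
    refine (ih (by omega)).bind fun t ht => ?_
    refine (run_consAll _ _).bind fun t₁ ht₁ => ?_
    rw [length_insertionsList] at ht₁
    simp [insertionsList]
    linarith

theorem run_extendAll (x : Fin n) (D : List (List (Fin n))) (hD : D.length < M)
    (h : ∀ d ∈ D, d.length < M) :
    Runs .extendAll [.atom x, encP D] (encP (extendAllList x D)) (100 * M ^ 3) := by
  suffices h : Runs .extendAll [.atom x, encP D] (encP (extendAllList x D))
        ((D.length + 1) * (100 * M ^ 2)) from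
    h.mono ((loop_le hD _).trans_eq (by ring))
  have hM : 1 ≤ M := by omega
  have hM' : M ≤ M ^ 2 := Nat.le_self_pow two_ne_zero M
  clear hD
  induction D with
  | nil =>
    simp [runs_iff, algorithmBody, extendAllList]
    omega
  | cons d D ih =>
    simp only [List.forall_mem_cons] at h
    simp only [runs_iff, algorithmBody]
    simp
    refine (run_insertions _ _ h.1).bind fun t ht => ?_
    refine (ih h.2).bind fun t₁ ht₁ => ?_
    refine (run_append _ _).bind fun t₂ ht₂ => ?_
    rw [length_insertionsList] at ht₂
    simp [extendAllList]
    linarith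

theorem run_before (y x : Fin n) (c : List (Fin n)) (hc : c.length < M) :
    Runs .before [.atom y, .atom x, encL c] (encB (decide ([y, x].Sublist c))) (60 * M) := by
  suffices h : Runs .before [.atom y, .atom x, encL c] (encB (decide ([y, x].Sublist c)))
      (60 * (c.length + 1)) from h.mono (by omega)
  clear hc
  induction c with
  | nil => simp [runs_iff, algorithmBody]
  | cons a c ih =>
    simp only [runs_iff, algorithmBody]
    simp
    refine ⟨fun h => (run_mem _ _).bind fun t ht => ?_, fun h => ih.bind fun t ht => ?_⟩
    · simp [h]
      omega
    · have : [y, x].Sublist (a :: c) ↔ [y, x].Sublist c := by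
        simp [List.cons_sublist_cons', h]
      simp [this]
      omega

theorem run_admissible (C : List (Fin n × Fin n)) (c : List (Fin n)) (hC : C.length < M)
    (hc : c.length < M) :
    Runs .admissible [encE C, encL c] (encB (decide (Admissible C c))) (200 * M ^ 2) := by
  suffices h : Runs .admissible [encE C, encL c] (encB (decide (Admissible C c)))
      ((C.length + 1) * (200 * M)) from
    h.mono ((loop_le hC _).trans_eq (by ring))
  clear hC
  induction C with
  | nil =>
    simp [runs_iff, algorithmBody, Admissible, Exp.tt]
    omega
  | cons e C ih =>
    have key : Admissible (e :: C) c ↔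
        (e.1 ≠ e.2 → e.1 ∈ c → e.2 ∈ c → [e.2, e.1].Sublist c) ∧ Admissible C c := by
      simp [Admissible]
    simp only [runs_iff, algorithmBody]
    simp only [key]
    simp
    refine ⟨fun h => ih.bind fun t ht => ?_, fun h => (run_mem _ _).bind fun t ht => ?_⟩
    · simp [h]
      linarith
    simp
    refine ⟨fun h' => (run_mem _ _).bind fun t₁ ht₁ => ?_, fun h' => ih.bind fun t₁ ht₁ => ?_⟩
    swap
    · simp [h']
      linarith
    simp
    refine ⟨fun h'' => (run_before _ _ _ hc).bind fun t₂ ht₂ => ?_,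
      fun h'' => ih.bind fun t₂ ht₂ => ?_⟩
    swap
    · simp [h'']
      linarith
    simp
    refine ⟨fun h₃ => ih.bind fun t₃ ht₃ => ?_, fun h₃ => ?_⟩
    · simp [h₃]
      linarith
    · simp [h, h', h'', h₃]
      linarith [Nat.zero_le (C.length * M)]

theorem run_onPath (u v : Fin n) (p : List (Fin n)) (hp : p.length < M) :
    Runs .onPath [.atom u, .atom v, encL p] (encB (decide ([v, u] <:+: p))) (40 * M) := by
  suffices h : Runs .onPath [.atom u, .atom v, encL p] (encB (decide ([v, u] <:+: p)))
      (40 * (p.length + 1)) from h.mono (by omega)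
  clear hp
  induction p with
  | nil => simp [runs_iff, algorithmBody]
  | cons a p ih =>
    rcases p with _ | ⟨b, p⟩
    · have : ¬ [v, u] <:+: [a] := fun h => by simpa using h.length_le
      simp [runs_iff, algorithmBody, this]
    · have key : [v, u] <:+: a :: b :: p ↔ (v = a ∧ u = b) ∨ [v, u] <:+: b :: p := by
        rw [List.infix_cons_iff]
        simp [List.cons_prefix_cons]
      simp only [runs_iff, algorithmBody]
      simp only [key]
      rw [encL_cons, encL_cons]
      rw [encL_cons] at ih
      simp [Exp.tt] 
      refine ⟨fun h => ⟨fun h' => ?_, fun h' => ih.bind fun t ht => ?_⟩,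
        fun h => ih.bind fun t ht => ?_⟩
      · simp [h, h']
        omega
      all_goals
        simp at ht
        simp [h]
        try simp [h']
        omega

theorem run_minusPath (E : List (Fin n × Fin n)) (p : List (Fin n)) (hE : E.length < M)
    (hp : p.length < M) :
    Runs .minusPath [encE E, encL p] (encE (minusPathList E p)) (100 * M ^ 2) := by
  suffices h : Runs .minusPath [encE E, encL p] (encE (minusPathList E p))
      ((E.length + 1) * (100 * M)) from
    h.mono ((loop_le hE _).trans_eq (by ring))
  clear hE
  induction E with
  | nil =>
    simp [runs_iff, algorithmBody, minusPathList]
    omega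
  | cons e E ih =>
    simp only [runs_iff, algorithmBody]
    simp
    refine (run_onPath _ _ _ hp).bind fun t ht => ?_
    simp
    refine ⟨fun h => ih.bind fun t₁ ht₁ => ?_, fun h => ih.bind fun t₁ ht₁ => ?_⟩
    all_goals
      simp [minusPathList, h]
      linarith

theorem run_covered (u v : Fin n) (T : List (List (Fin n))) (hT : T.length < M)
    (h : ∀ p ∈ T, p.length < M) :
    Runs .covered [.atom u, .atom v, encP T] (encB (decide (∃ p ∈ T, [v, u] <:+: p)))
      (100 * M ^ 2) := by
  suffices h : Runs .covered [.atom u, .atom v, encP T]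
      (encB (decide (∃ p ∈ T, [v, u] <:+: p))) ((T.length + 1) * (100 * M)) from
    h.mono ((loop_le hT _).trans_eq (by ring))
  have hM : 1 ≤ M := by omega
  clear hT
  induction T with
  | nil =>
    simp [runs_iff, algorithmBody]
    omega
  | cons p T ih =>
    simp only [List.forall_mem_cons] at h
    simp only [runs_iff, algorithmBody]
    simp
    refine (run_onPath _ _ _ h.1).bind fun t ht => ?_
    simp
    refine ⟨fun h' => ?_, fun h' => (ih h.2).bind fun t₁ ht₁ => ?_⟩
    all_goals
      simp [h', Exp.tt]
      linarith [Nat.zero_le (T.length * M)]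

theorem run_uncovered (E : List (Fin n × Fin n)) (T : List (List (Fin n))) (hE : E.length < M)
    (hT : T.length < M) (h : ∀ p ∈ T, p.length < M) :
    Runs .uncovered [encE E, encP T] (encE (uncoveredList E T)) (200 * M ^ 3) := by
  suffices h : Runs .uncovered [encE E, encP T] (encE (uncoveredList E T))
      ((E.length + 1) * (200 * M ^ 2)) from
    h.mono ((loop_le hE _).trans_eq (by ring))
  have hM : 1 ≤ M := by omega
  have hM' : M ≤ M ^ 2 := Nat.le_self_pow two_ne_zero M
  clear hE
  induction E with
  | nil =>
    simp [runs_iff, algorithmBody, uncoveredList]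
    linarith
  | cons e E ih =>
    simp only [runs_iff, algorithmBody]
    simp
    refine (run_covered _ _ _ hT h).bind fun t ht => ?_
    simp only [encB_eq_nil, decide_eq_false_iff_not, not_not]
    refine ⟨fun h => ih.bind fun t₁ ht₁ => ?_, fun h => ih.bind fun t₁ ht₁ => ?_⟩
    all_goals
      simp only [uncoveredList, List.filter_cons, decide_not]
      simp [h]
      linarith

theorem run_blocked (C : List (Fin n × Fin n)) (x : Fin n) (r : List (Fin n))
    (hC : C.length < M) (hr : r.length < M) :
    Runs .blocked [encE C, .atom x, encL r] (encB (decide (Blocked C x r))) (100 * M ^ 2) := by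
  suffices h : Runs .blocked [encE C, .atom x, encL r] (encB (decide (Blocked C x r)))
      ((C.length + 1) * (100 * M)) from
    h.mono ((loop_le hC _).trans_eq (by ring))
  clear hC
  induction C with
  | nil =>
    simp [runs_iff, algorithmBody, Blocked]
    omega
  | cons e C ih =>
    have key : Blocked (e :: C) x r ↔ (e.1 = x ∧ e.2 ∈ r) ∨ Blocked C x r := by
      simp [Blocked]
    simp only [runs_iff, algorithmBody]
    simp only [key]
    simp
    refine ⟨fun h => (run_mem _ _).bind fun t ht => ?_, fun h => ih.bind fun t ht => ?_⟩
    · simp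
      refine ⟨fun h' => ?_, fun h' => ih.bind fun t₁ ht₁ => ?_⟩
      · simp [h, h', Exp.tt]
        linarith [Nat.zero_le (C.length * M)]
      · simp [h']
        linarith
    · simp [Ne.symm h]
      linarith

theorem run_available (C : List (Fin n × Fin n)) (x : Fin n) (r : List (Fin n))
    (hC : 2 * C.length < M) (hr : r.length < M) :
    Runs .available [encE C, .atom x, encL r] (encB (decide (Available C x r)))
      (300 * M ^ 2) := by
  have hM : 1 ≤ M := by omega
  have hM' : M ≤ M ^ 2 := Nat.le_self_pow two_ne_zero M
  have hl := length_criticalList_le C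
  simp only [runs_iff, algorithmBody]
  simp
  refine (run_critical C hM hC).bind fun t ht => ?_
  refine (run_mem _ _).bind fun t₁ ht₁ => ?_
  simp
  refine ⟨fun h => (run_mem _ _).bind fun t₂ ht₂ => ?_, fun h => ?_⟩
  · simp
    refine ⟨fun h' => (run_blocked C x r (by omega) hr).bind fun t₃ ht₃ => ?_, fun h' => ?_⟩
    · simp
      refine ⟨fun h'' => ?_, fun h'' => ?_⟩
      all_goals
        simp [Available, h, h', h'', Exp.tt]
        linarith
    · simp [Available, h, h']
      linarith
  · simp [Available, h, Exp.tt]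
    linarith

theorem run_allowed (L : List (Fin n)) (C : List (Fin n × Fin n)) (r : List (Fin n))
    (hL : L.length < M) (hC : 2 * C.length < M) (hr : r.length < M) :
    Runs .allowed [encL L, encE C, encL r] (encL (L.filter fun x => Available C x r))
      (400 * M ^ 3) := by
  suffices h : Runs .allowed [encL L, encE C, encL r] (encL (L.filter fun x => Available C x r))
      ((L.length + 1) * (400 * M ^ 2)) from
    h.mono ((loop_le hL _).trans_eq (by ring))
  have hM : 1 ≤ M := by omega
  have hM' : M ≤ M ^ 2 := Nat.le_self_pow two_ne_zero M
  clear hL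
  induction L with
  | nil =>
    simp [runs_iff, algorithmBody]
    linarith
  | cons a L ih =>
    simp only [runs_iff, algorithmBody]
    simp
    refine (run_available _ _ _ hC hr).bind fun t ht => ?_
    simp
    refine ⟨fun h => ih.bind fun t₁ ht₁ => ?_, fun h => ih.bind fun t₁ ht₁ => ?_⟩
    all_goals
      simp [h]
      linarith

theorem run_findEnd (x : Fin n) (P : List (List (Fin n))) :
    Runs .findEnd [.atom x, encP P] (encL (findEndList x P)) (20 * (P.length + 1)) := by
  induction P with
  | nil => simp [runs_iff, algorithmBody, findEndList]
  | cons p P ih =>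
    simp only [runs_iff, algorithmBody]
    rcases p with _ | ⟨a, p⟩
    · simp
      refine ih.bind fun t ht => ?_
      simp [findEndList]
      omega
    · simp
      refine ⟨fun h => ?_, fun h => ih.bind fun t ht => ?_⟩
      · simp [findEndList, h]
        omega
      · simp [findEndList, Ne.symm h]
        omega

theorem run_relax (E : List (Fin n × Fin n)) (A : List (Fin n)) (P : List (List (Fin n)))
    (hA : A.length < M) (hP : P.length + E.length < M) :
    Runs .relax [encE E, encL A, encP P] (encP (relaxList A E P)) (100 * M ^ 2) := by
  suffices h : Runs .relax [encE E, encL A, encP P] (encP (relaxList A E P))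
      ((E.length + 1) * (100 * M)) from
    h.mono ((loop_le (l := E.length) (M := M) (by omega) _).trans_eq (by ring))
  induction E generalizing P with
  | nil =>
    simp [runs_iff, algorithmBody, relaxList]
    omega
  | cons e E ih =>
    simp only [List.length_cons] at hP
    simp only [runs_iff, algorithmBody]
    simp [relaxList]
    refine (run_mem _ _).bind fun t ht => ?_
    simp
    refine ⟨fun h => (run_findEnd _ _).bind fun t₁ ht₁ => ?_,
      fun h => (ih P (by omega)).bind fun t₁ ht₁ => ?_⟩
    swap
    · simp [h]
      linarith
    simp
    refine ⟨fun h' => (ih P (by omega)).bind fun t₂ ht₂ => ?_,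
      fun h' => (run_findEnd _ _).bind fun t₂ ht₂ => ?_⟩
    · simp [h']
      linarith
    simp
    refine ⟨fun h'' => (run_findEnd _ _).bind fun t₃ ht₃ =>
      (ih ((e.2 :: findEndList e.1 P) :: P) (by simp; omega)).bind fun t₄ ht₄ => ?_,
      fun h'' => (ih P (by omega)).bind fun t₃ ht₃ => ?_⟩
    all_goals
      simp [h, h', h'']
      linarith

theorem run_closure (L : List (Fin n)) (E : List (Fin n × Fin n)) (A : List (Fin n))
    (P : List (List (Fin n))) (hA : A.length < M)
    (hP : P.length + (L.length + 1) * E.length + L.length < M) :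
    Runs .closure [encL L, encE E, encL A, encP P] (encP ((relaxList A E)^[L.length] P))
      (200 * M ^ 3) := by
  suffices h : Runs .closure [encL L, encE E, encL A, encP P]
      (encP ((relaxList A E)^[L.length] P)) ((L.length + 1) * (200 * M ^ 2)) from
    h.mono ((loop_le (l := L.length) (M := M) (by omega) _).trans_eq (by ring))
  have hM : 1 ≤ M := by omega
  have hM' : M ≤ M ^ 2 := Nat.le_self_pow two_ne_zero M
  induction L generalizing P with
  | nil =>
    simp [runs_iff, algorithmBody]
    linarith
  | cons a L ih =>
    simp only [List.length_cons] at hP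
    have := length_relaxList_le A E P
    simp only [runs_iff, algorithmBody]
    simp
    refine (run_relax E A P hA (by nlinarith)).bind fun t ht => ?_
    refine (ih _ (by nlinarith)).bind fun t₁ ht₁ => ?_
    simp
    linarith

theorem run_endAt (y : Fin n) (E : List (Fin n × Fin n)) (P : List (List (Fin n)))
    (hE : E.length < M) (hP : P.length < M) :
    Runs .endAt [.atom y, encE E, encP P] (encL (endAtList y P E)) (100 * M ^ 2) := by
  suffices h : Runs .endAt [.atom y, encE E, encP P] (encL (endAtList y P E))
      ((E.length + 1) * (100 * M)) from
    h.mono ((loop_le hE _).trans_eq (by ring))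
  clear hE
  induction E with
  | nil =>
    simp [runs_iff, algorithmBody, endAtList]
    omega
  | cons e E ih =>
    simp only [runs_iff, algorithmBody]
    simp [endAtList]
    refine ⟨fun h => (run_findEnd _ _).bind fun t ht => ?_, fun h => ih.bind fun t ht => ?_⟩
    swap
    · simp [h]
      linarith
    simp
    refine ⟨fun h' => (run_findEnd _ _).bind fun t₁ ht₁ => ?_, fun h' => ih.bind fun t₁ ht₁ => ?_⟩
    all_goals
      simp [h, h']
      linarith [Nat.zero_le (E.length * M)]

/-! ### The search for a path -/

section
variable {V : Type} [DecidableEq V]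

theorem length_iterate_relaxList_le (A : List V) (E : List (V × V)) (k : ℕ)
    (P : List (List V)) :
    ((relaxList A E)^[k] P).length ≤ P.length + k * E.length := by
  induction k generalizing P with
  | zero => simp
  | succ k ih =>
    have h₁ := ih (relaxList A E P)
    have h₂ := length_relaxList_le A E P
    rw [Function.iterate_succ_apply]
    linarith

theorem length_findEndList_le {x : V} {P : List (List V)} {b : ℕ}
    (h : ∀ p ∈ P, p.length ≤ b) : (findEndList x P).length ≤ b := by
  induction P with
  | nil => simp [findEndList]
  | cons p P ih =>
    rw [List.forall_mem_cons] at h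
    rw [findEndList]
    split
    · exact h.1
    · exact ih h.2

theorem length_le_of_mem_relaxList {A : List V} {E : List (V × V)} {P : List (List V)} {b : ℕ}
    (h : ∀ p ∈ P, p.length ≤ b) : ∀ p ∈ relaxList A E P, p.length ≤ b + E.length := by
  induction E generalizing P b with
  | nil => simpa [relaxList] using h
  | cons e E ih =>
    rw [relaxList]
    intro p hp
    split at hp
    · have := ih (b := b + 1) (P := (e.2 :: findEndList e.1 P) :: P) (by
        rw [List.forall_mem_cons]
        exact ⟨by simpa using length_findEndList_le h, fun q hq => (h q hq).trans (by omega)⟩)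
        p hp
      simp only [List.length_cons]
      omega
    · have := ih h p hp
      simp only [List.length_cons]
      omega

theorem length_le_of_mem_iterate_relaxList {A : List V} {E : List (V × V)} {k : ℕ}
    {P : List (List V)} {b : ℕ} (h : ∀ p ∈ P, p.length ≤ b) :
    ∀ p ∈ (relaxList A E)^[k] P, p.length ≤ b + k * E.length := by
  induction k generalizing P b with
  | zero => simpa using h
  | succ k ih =>
    intro p hp
    rw [Function.iterate_succ_apply] at hp
    have := ih (length_le_of_mem_relaxList h) p hp
    linarith

theorem length_endAtList_le {y : V} {E : List (V × V)} {P : List (List V)} {b : ℕ}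
    (h : ∀ p ∈ P, p.length ≤ b) : (endAtList y P E).length ≤ b + 1 := by
  induction E with
  | nil => simp [endAtList]
  | cons e E ih =>
    rw [endAtList]
    split
    · simpa using length_findEndList_le h
    · exact ih

/-- The reversed paths found in `k` rounds of the search that starts from the path `p`. -/
def closureList (E : List (V × V)) (k : ℕ) (A p : List V) : List (List V) :=
  (relaxList A E)^[k] [p]

/-- The path `p` extended to `y`, all new vertices but the last one being in `A`; `[]` if there is no
such path. -/
def plainToList (E : List (V × V)) (k : ℕ) (A p : List V) (y : V) : List V :=
  if findEndList y (closureList E k A p) = [] then endAtList y (closureList E k A p) E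
  else findEndList y (closureList E k A p)

/-- The path `q` extended by the vertex `v`, and then to `y`. -/
def continueToList (E : List (V × V)) (k : ℕ) (A q : List V) (v y : V) : List V :=
  if q ≠ [] ∧ (v = y ∨ v ∈ A) then plainToList E k A (v :: q) y else []

/-- The path `p` extended to `y` so that the new part contains the edge `(u, v)` and all new vertices
but the last one are in `A`. -/
def throughToList (E : List (V × V)) (k : ℕ) (A p : List V) (u v y : V) : List V :=
  continueToList E k A (findEndList u (closureList E k A p)) v y

/-- The path `p` extended to `y`, through `(u, v)` if this edge is missing and this is possible. -/
def segmentList (E : List (V × V)) (k : ℕ) (A p : List V) (u v y : V) : List V :=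
  if [v, u] <:+: p then plainToList E k A p y
  else if throughToList E k A p u v y = [] then plainToList E k A p y
  else throughToList E k A p u v y

/-- The path `p` extended to `t`, through `(u, v)` if this edge is missing. -/
def finishList (E : List (V × V)) (k : ℕ) (A p : List V) (u v t : V) : List V :=
  if [v, u] <:+: p then plainToList E k A p t else throughToList E k A p u v t

variable {E : List (V × V)} {k : ℕ} {A p : List V} {u v y : V}

theorem length_closureList_le : (closureList E k A p).length ≤ 1 + k * E.length :=
  length_iterate_relaxList_le A E k [p]

theorem length_le_of_mem_closureList :
    ∀ q ∈ closureList E k A p, q.length ≤ p.length + k * E.length :=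
  length_le_of_mem_iterate_relaxList (by simp)

theorem length_plainToList_le :
    (plainToList E k A p y).length ≤ p.length + (k * E.length + 1) := by
  rw [plainToList]
  split
  · exact length_endAtList_le length_le_of_mem_closureList
  · exact (length_findEndList_le length_le_of_mem_closureList).trans (by omega)

theorem length_throughToList_le :
    (throughToList E k A p u v y).length ≤ p.length + 2 * (k * E.length + 1) := by
  rw [throughToList, continueToList]
  split
  · have h₁ := length_findEndList_le (x := u)
      (length_le_of_mem_closureList (E := E) (k := k) (A := A) (p := p))
    refine length_plainToList_le.trans ?_
    simp only [List.length_cons]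
    omega
  · simp

theorem length_segmentList_le :
    (segmentList E k A p u v y).length ≤ p.length + 2 * (k * E.length + 1) := by
  have h₁ := length_plainToList_le (E := E) (k := k) (A := A) (p := p) (y := y)
  rw [segmentList]
  split
  · omega
  split
  · omega
  · exact length_throughToList_le

theorem length_finishList_le :
    (finishList E k A p u v y).length ≤ p.length + 2 * (k * E.length + 1) := by
  have h₁ := length_plainToList_le (E := E) (k := k) (A := A) (p := p) (y := y)
  rw [finishList]
  split
  · omega
  · exact length_throughToList_le

end

namespace PresentedCCFG

variable (I : PresentedCCFG)

/-- The vertices that may be inner vertices of the segment during which `r` is the part of the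
sequence not yet reached. -/
def allowed (r : List (Fin I.n)) : List (Fin I.n) :=
  (List.finRange I.n).filter fun x => Available I.constraints x r

/-- The loop over the elements of the sequence, of which `r` is what is left. -/
def walk (u v : Fin I.n) : List (Fin I.n) → List (Fin I.n) → List (Fin I.n)
  | [], p => if p = [] then [] else finishList I.edges I.n (I.allowed []) p u v I.G.t
  | y :: r, p =>
    if p = [] then []
    else walk u v r (segmentList I.edges I.n (I.allowed (y :: r)) p u v y)

/-- If `x` occurs in a constraint then it is in `c`. -/
def InitOk (x : Fin I.n) (c : List (Fin I.n)) : Prop :=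
  x ∈ criticalList I.constraints → x ∈ c

instance (x : Fin I.n) (c : List (Fin I.n)) : Decidable (I.InitOk x c) := by
  unfold InitOk
  infer_instance

/-- The result of FindProperPath, in reversed form. -/
def properPath (c : List (Fin I.n)) (u v : Fin I.n) : List (Fin I.n) :=
  if I.InitOk I.G.s c ∧ I.InitOk I.G.t c then I.walk u v c [I.G.s] else []

/-- The number `M` bounds the lengths of all lists that appear during the search for a path. -/
structure Fits (M : ℕ) : Prop where
  vertices : I.n < M
  edges : I.edges.length < M
  constraints : 2 * I.constraints.length < M
  search : 1 + (I.n + 1) * I.edges.length + I.n < M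
  path : 1 + (2 * I.constraints.length + 1) * (2 * (I.n * I.edges.length + 1)) < M

variable {I}

theorem length_walk_le (u v : Fin I.n) (r p : List (Fin I.n)) :
    (I.walk u v r p).length ≤
      p.length + (r.length + 1) * (2 * (I.n * I.edges.length + 1)) := by
  induction r generalizing p with
  | nil =>
    rw [walk]
    split
    · simp
    · simpa using length_finishList_le
  | cons y r ih =>
    rw [walk]
    split
    · simp
    · refine (ih _).trans ?_
      have := length_segmentList_le (E := I.edges) (k := I.n) (A := I.allowed (y :: r)) (p := p)
        (u := u) (v := v) (y := y)
      simp only [List.length_cons]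
      linarith

theorem length_properPath_le (c : List (Fin I.n)) (u v : Fin I.n) :
    (I.properPath c u v).length ≤
      1 + (c.length + 1) * (2 * (I.n * I.edges.length + 1)) := by
  rw [properPath]
  split
  · exact length_walk_le u v c _
  · simp

@[simp] theorem hd_enc : I.enc.hd = encL (List.finRange I.n) := rfl
@[simp] theorem hd_tl_enc : I.enc.tl.hd = encE I.edges := rfl
@[simp] theorem hd_tl_tl_enc : I.enc.tl.tl.hd = .atom I.G.s := rfl
@[simp] theorem hd_tl_tl_tl_enc : I.enc.tl.tl.tl.hd = .atom I.G.t := rfl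
@[simp] theorem hd_tl_tl_tl_tl_enc : I.enc.tl.tl.tl.tl.hd = encE I.constraints := rfl

variable {M : ℕ}

theorem length_allowed_lt (hM : I.Fits M) (r : List (Fin I.n)) : (I.allowed r).length < M :=
  ((List.length_filter_le _ _).trans_eq List.length_finRange).trans_lt hM.vertices

theorem Fits.one_le (hM : I.Fits M) : 1 ≤ M :=
  (Nat.zero_le _).trans_lt hM.vertices

theorem run_closure_enc (hM : I.Fits M) {A p : List (Fin I.n)} (hA : A.length < M) :
    Runs .closure [encL (List.finRange I.n), encE I.edges, encL A, (encL p).cons .nil]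
      (encP (closureList I.edges I.n A p)) (200 * M ^ 3) := by
  have := run_closure (List.finRange I.n) I.edges A [p] hA (by simpa using hM.search)
  rwa [List.length_finRange] at this

theorem Fits.length_closureList_lt (hM : I.Fits M) {A p : List (Fin I.n)} :
    (closureList I.edges I.n A p).length < M := by
  have h₁ := length_closureList_le (E := I.edges) (k := I.n) (A := A) (p := p)
  have h₂ := hM.search
  linarith

theorem run_plainTo (hM : I.Fits M) {A p : List (Fin I.n)} {y : Fin I.n} (hA : A.length < M) :
    Runs .plainTo [I.enc, encL A, encL p, .atom y] (encL (plainToList I.edges I.n A p y))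
      (600 * M ^ 3) := by
  obtain ⟨h₁, h₂, h₃, h₄⟩ := pow_chain hM.one_le
  have h₀ := hM.one_le
  have hP := hM.length_closureList_lt (A := A) (p := p)
  simp only [runs_iff, algorithmBody, Exp.gV, Exp.gE]
  simp
  refine (run_closure_enc hM hA).bind fun t ht => ?_
  refine (run_findEnd _ _).bind fun t₁ ht₁ => ?_
  refine (run_closure_enc hM hA).bind fun t₂ ht₂ => ?_
  refine (run_endAt _ _ _ hM.edges hP).bind fun t₃ ht₃ => ?_
  refine (run_orElse _ _).bind fun t₄ ht₄ => ⟨rfl, ?_⟩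
  linarith

theorem run_continueTo (hM : I.Fits M) {A q : List (Fin I.n)} {v y : Fin I.n}
    (hA : A.length < M) :
    Runs .continueTo [I.enc, encL A, encL q, .atom v, .atom y]
      (encL (continueToList I.edges I.n A q v y)) (700 * M ^ 3) := by
  obtain ⟨h₁, h₂, h₃, h₄⟩ := pow_chain hM.one_le
  have h₀ := hM.one_le
  simp only [runs_iff, algorithmBody]
  simp [Exp.tt, continueToList]
  refine ⟨fun h => ⟨fun h' => ?_, fun h' => ?_⟩, fun h => ?_⟩
  · have := run_plainTo hM (p := v :: q) (y := y) hA
    rw [encL_cons] at this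
    refine this.bind fun t ht => ?_
    simp [h, h']
    linarith
  · refine (run_mem _ _).bind fun t ht => ?_
    simp
    refine ⟨fun h'' => ?_, fun h'' => ?_⟩
    · have := run_plainTo hM (p := v :: q) (y := y) hA
      rw [encL_cons] at this
      refine this.bind fun t ht => ?_
      simp [h, h'']
      linarith
    · simp [h', h'']
      linarith
  · simp [h]
    linarith

theorem run_throughTo (hM : I.Fits M) {A p : List (Fin I.n)} {u v y : Fin I.n}
    (hA : A.length < M) :
    Runs .throughTo [I.enc, encL A, encL p, .atom u, .atom v, .atom y]
      (encL (throughToList I.edges I.n A p u v y)) (1000 * M ^ 3) := by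
  obtain ⟨h₁, h₂, h₃, h₄⟩ := pow_chain hM.one_le
  have h₀ := hM.one_le
  have hP := hM.length_closureList_lt (A := A) (p := p)
  simp only [runs_iff, algorithmBody, Exp.gV, Exp.gE]
  simp
  refine (run_closure_enc hM hA).bind fun t ht => ?_
  refine (run_findEnd _ _).bind fun t₁ ht₁ => ?_
  refine (run_continueTo hM hA).bind fun t₂ ht₂ => ⟨rfl, ?_⟩
  linarith

theorem run_segment (hM : I.Fits M) {A p : List (Fin I.n)} {u v y : Fin I.n}
    (hA : A.length < M) (hp : p.length < M) :
    Runs .segment [I.enc, encL A, encL p, .atom u, .atom v, .atom y]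
      (encL (segmentList I.edges I.n A p u v y)) (2000 * M ^ 3) := by
  obtain ⟨h₁, h₂, h₃, h₄⟩ := pow_chain hM.one_le
  have h₀ := hM.one_le
  simp only [runs_iff, algorithmBody]
  simp
  refine (run_onPath _ _ _ hp).bind fun t ht => ?_
  simp
  refine ⟨fun h => (run_plainTo hM hA).bind fun t₁ ht₁ => ?_,
    fun h => (run_throughTo hM hA).bind fun t₁ ht₁ => ?_⟩
  · simp [segmentList, h]
    linarith
  · refine (run_plainTo hM hA).bind fun t₂ ht₂ => ?_
    refine (run_orElse _ _).bind fun t₃ ht₃ => ?_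
    simp [segmentList, h]
    linarith

theorem run_finish (hM : I.Fits M) {A p : List (Fin I.n)} {u v : Fin I.n}
    (hA : A.length < M) (hp : p.length < M) :
    Runs .finish [I.enc, encL A, encL p, .atom u, .atom v]
      (encL (finishList I.edges I.n A p u v I.G.t)) (2000 * M ^ 3) := by
  obtain ⟨h₁, h₂, h₃, h₄⟩ := pow_chain hM.one_le
  have h₀ := hM.one_le
  simp only [runs_iff, algorithmBody, Exp.gt]
  simp
  refine (run_onPath _ _ _ hp).bind fun t ht => ?_
  simp
  refine ⟨fun h => (run_plainTo hM hA).bind fun t₁ ht₁ => ?_,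
    fun h => (run_throughTo hM hA).bind fun t₁ ht₁ => ?_⟩
  all_goals
    simp [finishList, h]
    linarith

theorem run_allowed_enc (hM : I.Fits M) {r : List (Fin I.n)} (hr : r.length < M) :
    Runs .allowed [encL (List.finRange I.n), encE I.constraints, encL r] (encL (I.allowed r))
      (400 * M ^ 3) :=
  run_allowed _ _ _ (by simpa using hM.vertices) hM.constraints hr

theorem run_walk (hM : I.Fits M) {r p : List (Fin I.n)} {u v : Fin I.n} (hr : r.length < M)
    (hp : p.length + r.length * (2 * (I.n * I.edges.length + 1)) < M) :
    Runs .walk [I.enc, encL r, encL p, .atom u, .atom v] (encL (I.walk u v r p))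
      (3000 * M ^ 4) := by
  suffices h : Runs .walk [I.enc, encL r, encL p, .atom u, .atom v] (encL (I.walk u v r p))
      ((r.length + 1) * (3000 * M ^ 3)) from
    h.mono ((loop_le hr _).trans_eq (by ring))
  obtain ⟨h₁, h₂, h₃, h₄⟩ := pow_chain hM.one_le
  have h₀ := hM.one_le
  induction r generalizing p with
  | nil =>
    simp only [runs_iff, algorithmBody, Exp.gV, Exp.gC, walk]
    simp
    refine ⟨fun h => ?_, fun h => ?_⟩
    · rw [← encL_nil (n := I.n)]
      refine (run_allowed_enc hM hr).bind fun t ht => ?_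
      refine (run_finish hM (length_allowed_lt hM _) (by simpa using hp)).bind fun t₁ ht₁ => ?_
      simp [h]
      linarith
    · simp [h]
      linarith
  | cons y r ih =>
    have hl := length_segmentList_le (E := I.edges) (k := I.n) (A := I.allowed (y :: r)) (p := p)
        (u := u) (v := v) (y := y)
    have hr' := hr
    simp only [List.length_cons] at hr hp
    simp only [runs_iff, algorithmBody, Exp.gV, Exp.gC, walk]
    simp [-encL_cons]
    refine ⟨fun h => ?_, fun h => ?_⟩
    · refine (run_allowed_enc hM hr').bind fun t ht => ?_
      rw [encL_cons]
      refine (run_segment hM (length_allowed_lt hM _)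
        ((Nat.le_add_right _ _).trans_lt hp)).bind fun t₁ ht₁ => ?_
      refine (ih (by omega) (by linarith)).bind fun t₂ ht₂ => ?_
      simp [h]
      linarith
    · simp [h]
      nlinarith

theorem run_initOk (hM : I.Fits M) (x : Fin I.n) {c : List (Fin I.n)} (hc : c.length < M) :
    Runs .initOk [.atom x, encE I.constraints, encL c] (encB (decide (I.InitOk x c)))
      (200 * M ^ 2) := by
  obtain ⟨h₁, h₂, h₃, h₄⟩ := pow_chain hM.one_le
  have h₀ := hM.one_le
  have hl := length_criticalList_le I.constraints
  have hC := hM.constraints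
  simp only [runs_iff, algorithmBody]
  simp
  refine (run_critical _ h₀ hC).bind fun t ht => ?_
  refine (run_mem _ _).bind fun t₁ ht₁ => ?_
  simp
  refine ⟨fun h => (run_mem _ _).bind fun t₂ ht₂ => ?_, fun h => ?_⟩
  all_goals
    simp [InitOk, h, Exp.tt]
    linarith

theorem run_findProperPath (hM : I.Fits M) {c : List (Fin I.n)} {u v : Fin I.n}
    (hc : c.length ≤ 2 * I.constraints.length) :
    Runs .findProperPath [I.enc, encL c, .atom u, .atom v] (encL (I.properPath c u v))
      (4000 * M ^ 4) := by
  obtain ⟨h₁, h₂, h₃, h₄⟩ := pow_chain hM.one_le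
  have h₀ := hM.one_le
  have hc' : c.length < M := hc.trans_lt hM.constraints
  have hp : 1 + c.length * (2 * (I.n * I.edges.length + 1)) < M :=
    (Nat.add_le_add_left (Nat.mul_le_mul_right _ (by omega)) 1).trans_lt hM.path
  simp only [runs_iff, algorithmBody, Exp.gs, Exp.gt, Exp.gC]
  simp
  refine (run_initOk hM _ hc').bind fun t ht => ?_
  simp
  refine ⟨fun h => (run_initOk hM _ hc').bind fun t₁ ht₁ => ?_, fun h => ?_⟩
  · simp
    refine ⟨fun h' => ?_, fun h' => ?_⟩
    · have := run_walk hM (r := c) (p := [I.G.s]) (u := u) (v := v) hc' (by simpa using hp)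
      rw [encL_cons, encL_nil] at this
      refine this.bind fun t₂ ht₂ => ?_
      simp [properPath, h, h']
      linarith
    · simp [properPath, h']
      linarith
  · simp [properPath, h]
    linarith

end PresentedCCFG

/-! ### Correctness of the search -/

section
variable {V : Type} [DecidableEq V]

/-- Consecutive elements of the reversed path `q` are joined by edges in `E`. -/
def IsRevChain {W : Type} (E : List (W × W)) (q : List W) : Prop :=
  q.IsChain fun b a => (a, b) ∈ E

/-- The reversed path `q` extends the reversed path `p`, and all new vertices but the last one
are in `A`. -/
def IsExtension {W : Type} (E : List (W × W)) (A p q : List W) : Prop :=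
  ∃ w, q = w ++ p ∧ (∀ z ∈ w.tail, z ∈ A) ∧ IsRevChain E q

theorem IsRevChain.cons {W : Type} {E : List (W × W)} {q : List W} {x y : W}
    (hq : IsRevChain E q) (hx : q.head? = some x) (h : (x, y) ∈ E) : IsRevChain E (y :: q) := by
  rcases q with _ | ⟨a, q⟩
  · simp at hx
  · obtain rfl : a = x := by simpa using hx
    exact List.isChain_cons_cons.2 ⟨h, hq⟩

theorem findEndList_spec {x : V} {P : List (List V)} (h : findEndList x P ≠ []) :
    findEndList x P ∈ P ∧ (findEndList x P).head? = some x := by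
  induction P with
  | nil => simp [findEndList] at h
  | cons p P ih =>
    rw [findEndList] at h ⊢
    split
    · exact ⟨by simp, by assumption⟩
    · rw [if_neg (by assumption)] at h
      exact ⟨List.mem_cons_of_mem _ (ih h).1, (ih h).2⟩

theorem findEndList_singleton {x : V} {p : List V} (h : p.head? = some x) :
    findEndList x [p] = p := by
  rw [findEndList, if_pos h]

/-- The search never replaces the path that it has found to a vertex. -/
theorem findEndList_relaxList {z : V} {A : List V} {E : List (V × V)} {P : List (List V)}
    (h : findEndList z P ≠ []) : findEndList z (relaxList A E P) = findEndList z P := by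
  induction E generalizing P with
  | nil => rfl
  | cons e E ih =>
    rw [relaxList]
    split
    · rename_i hc
      have hz : ¬ e.2 = z := by
        rintro rfl
        exact h hc.2.1
      have key : findEndList z ((e.2 :: findEndList e.1 P) :: P) = findEndList z P := by
        rw [findEndList, if_neg (by simpa using hz)]
      rw [ih (by rwa [key]), key]
    · exact ih h

theorem findEndList_iterate_relaxList {z : V} {A : List V} {E : List (V × V)} {k : ℕ}
    {P : List (List V)} (h : findEndList z P ≠ []) :
    findEndList z ((relaxList A E)^[k] P) = findEndList z P := by
  induction k generalizing P with
  | zero => rfl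
  | succ k ih =>
    have := findEndList_relaxList (A := A) (E := E) h
    rw [Function.iterate_succ_apply, ih (by rwa [this]), this]

/-- An invariant of paths that is kept when a path is extended by an edge into `A` holds for all
paths found. -/
theorem forall_mem_relaxList {S : List V → Prop} {A : List V} {E : List (V × V)}
    {P : List (List V)}
    (hS : ∀ q x y, S q → q.head? = some x → (x, y) ∈ E → y ∈ A → S (y :: q))
    (h : ∀ q ∈ P, S q) : ∀ q ∈ relaxList A E P, S q := by
  induction E generalizing P with
  | nil => exact h
  | cons e E ih =>
    have ih' := fun (P : List (List V)) => ih (P := P) fun q x y hq hx hxy =>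
      hS q x y hq hx (List.mem_cons_of_mem _ hxy)
    rw [relaxList]
    split
    · rename_i hc
      have hs := findEndList_spec hc.2.2
      refine ih' _ (List.forall_mem_cons.2 ⟨?_, h⟩)
      exact hS _ e.1 e.2 (h _ hs.1) hs.2 (by simp) hc.1
    · exact ih' _ h

variable {E : List (V × V)} {k : ℕ} {A p q l : List V} {u v x y z : V}

/-- The paths found by the search extend `p` by vertices in `A`. -/
theorem closureList_sound (hp : IsRevChain E p) (hq : q ∈ closureList E k A p) :
    ∃ w, q = w ++ p ∧ (∀ z ∈ w, z ∈ A) ∧ IsRevChain E q := by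
  suffices h : ∀ P : List (List V),
      (∀ q ∈ P, ∃ w, q = w ++ p ∧ (∀ z ∈ w, z ∈ A) ∧ IsRevChain E q) →
      ∀ q ∈ (relaxList A E)^[k] P, ∃ w, q = w ++ p ∧ (∀ z ∈ w, z ∈ A) ∧ IsRevChain E q from
    h [p] (fun q hq => ⟨[], by simpa using hq, by simp, by rwa [List.mem_singleton.1 hq]⟩) q hq
  intro P hP
  clear hq
  induction k generalizing P with
  | zero => exact hP
  | succ k ih =>
    rw [Function.iterate_succ_apply]
    refine ih _ (forall_mem_relaxList ?_ hP)
    rintro q x y ⟨w, rfl, hw, hq⟩ hx hxy hy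
    exact ⟨y :: w, rfl, List.forall_mem_cons.2 ⟨hy, hw⟩, hq.cons hx hxy⟩

/-- The vertices to which `P` holds a path are closed under the edges that lead into `A`. -/
def IsClosedUnder (E : List (V × V)) (A : List V) (P : List (List V)) : Prop :=
  ∀ e ∈ E, e.2 ∈ A → findEndList e.1 P ≠ [] → findEndList e.2 P ≠ []

theorem relaxList_of_isClosedUnder {P : List (List V)} (h : IsClosedUnder E A P) :
    relaxList A E P = P := by
  induction E with
  | nil => rfl
  | cons e E ih =>
    rw [relaxList, if_neg]
    · exact ih fun e' he' => h e' (List.mem_cons_of_mem _ he')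
    · rintro ⟨h₁, h₂, h₃⟩
      exact h e (by simp) h₁ h₃ h₂

theorem findEndList_relaxList_ne_nil {P : List (List V)} {e : V × V} (he : e ∈ E)
    (hA : e.2 ∈ A) (h : findEndList e.1 P ≠ []) : findEndList e.2 (relaxList A E P) ≠ [] := by
  induction E generalizing P with
  | nil => simp at he
  | cons e' E ih =>
    rw [relaxList]
    rcases List.mem_cons.1 he with rfl | he
    · split
      · have : findEndList e.2 ((e.2 :: findEndList e.1 P) :: P) ≠ [] := by
          simp [findEndList]
        rwa [findEndList_relaxList this]
      · rename_i hc
        have : findEndList e.2 P ≠ [] := fun h' => hc ⟨hA, h', h⟩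
        rwa [findEndList_relaxList this]
    · split
      · refine ih he ?_
        rw [findEndList]
        split
        · simp
        · exact h
      · exact ih he h

/-- As long as the set of reached vertices is not closed it grows in every round. -/
theorem isClosedUnder_or_le_card [Fintype V] (P : List (List V)) (k : ℕ) :
    IsClosedUnder E A ((relaxList A E)^[k] P) ∨
      k + (Finset.univ.filter fun x => findEndList x P ≠ []).card ≤
        (Finset.univ.filter fun x => findEndList x ((relaxList A E)^[k] P) ≠ []).card := by
  induction k with
  | zero => exact Or.inr (Nat.zero_add _).le
  | succ k ih =>
    rw [Function.iterate_succ_apply']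
    set P' := (relaxList A E)^[k] P
    by_cases hc : IsClosedUnder E A P'
    · left
      rwa [relaxList_of_isClosedUnder hc]
    · right
      have hlt : (Finset.univ.filter fun x => findEndList x P' ≠ []).card <
          (Finset.univ.filter fun x => findEndList x (relaxList A E P') ≠ []).card := by
        simp only [IsClosedUnder, not_forall] at hc
        obtain ⟨e, he, hA, h₁, h₂⟩ := hc
        refine Finset.card_lt_card (Finset.ssubset_iff_subset_ne.2 ⟨fun x hx => ?_, fun h => h₂ ?_⟩)
        · simp only [Finset.mem_filter, Finset.mem_univ, true_and] at hx ⊢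
          rwa [findEndList_relaxList hx]
        · have := findEndList_relaxList_ne_nil he hA h₁
          have h' : e.2 ∈ Finset.univ.filter fun x => findEndList x (relaxList A E P') ≠ [] := by
            simpa using this
          rw [← h] at h'
          simpa using h'
      have := ih.resolve_left hc
      omega

/-- As many rounds as there are vertices suffice: otherwise more vertices would be reached than
there are. -/
theorem isClosedUnder_closureList [Fintype V] (hk : Fintype.card V ≤ k) (hp : p.head? = some z) :
    IsClosedUnder E A (closureList E k A p) := by
  refine (isClosedUnder_or_le_card [p] k).resolve_right fun h => ?_
  have h₁ : z ∈ Finset.univ.filter fun x => findEndList x [p] ≠ [] := by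
    simp only [Finset.mem_filter, Finset.mem_univ, true_and, findEndList_singleton hp]
    rintro rfl
    simp at hp
  have h₂ := Finset.card_pos.2 ⟨z, h₁⟩
  have h₃ := Finset.card_le_univ
    (Finset.univ.filter fun x => findEndList x ((relaxList A E)^[k] [p]) ≠ [])
  omega

theorem IsClosedUnder.findEndList_ne_nil {P : List (List V)} (h : IsClosedUnder E A P)
    (hz : findEndList z P ≠ []) (hl : (z :: l).IsChain fun a b => (a, b) ∈ E)
    (hA : ∀ x ∈ l, x ∈ A) : ∀ x ∈ z :: l, findEndList x P ≠ [] := by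
  induction l generalizing z with
  | nil => simpa using hz
  | cons a l ih =>
    rw [List.isChain_cons_cons] at hl
    rw [List.forall_mem_cons] at hA
    exact List.forall_mem_cons.2 ⟨hz, ih (h _ hl.1 hA.1 hz) hl.2 hA.2⟩

theorem ne_nil_of_head? {W : Type} {p : List W} {z : W} (hp : p.head? = some z) : p ≠ [] := by
  rintro rfl
  simp at hp

theorem findEndList_closureList_self (hp : p.head? = some z) :
    findEndList z (closureList E k A p) = p := by
  have h := findEndList_singleton hp
  rw [closureList, findEndList_iterate_relaxList (by rw [h]; exact ne_nil_of_head? hp), h]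

theorem findEndList_closureList_ne_nil [Fintype V] (hk : Fintype.card V ≤ k)
    (hp : p.head? = some z) (hl : (z :: l).IsChain fun a b => (a, b) ∈ E)
    (hA : ∀ x ∈ l, x ∈ A) : ∀ x ∈ z :: l, findEndList x (closureList E k A p) ≠ [] :=
  (isClosedUnder_closureList hk hp).findEndList_ne_nil
    (by rw [findEndList_closureList_self hp]; exact ne_nil_of_head? hp) hl hA

theorem endAtList_spec {P : List (List V)} (h : endAtList y P E ≠ []) :
    ∃ x, (x, y) ∈ E ∧ findEndList x P ≠ [] ∧ endAtList y P E = y :: findEndList x P := by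
  induction E with
  | nil => simp [endAtList] at h
  | cons e E ih =>
    rw [endAtList] at h ⊢
    split at h
    · rename_i hc
      rw [if_pos hc]
      exact ⟨e.1, by simp [hc.1], hc.2, rfl⟩
    · rename_i hc
      rw [if_neg hc]
      obtain ⟨x, hx, h'⟩ := ih h
      exact ⟨x, List.mem_cons_of_mem _ hx, h'⟩

theorem endAtList_ne_nil {P : List (List V)} (hxy : (x, y) ∈ E) (hx : findEndList x P ≠ []) :
    endAtList y P E ≠ [] := by
  induction E with
  | nil => simp at hxy
  | cons e E ih =>
    rw [endAtList]
    split
    · simp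
    · rename_i hc
      rcases List.mem_cons.1 hxy with rfl | hxy
      · exact absurd ⟨rfl, hx⟩ hc
      · exact ih hxy

theorem plainToList_self (hp : p.head? = some y) : plainToList E k A p y = p := by
  rw [plainToList, findEndList_closureList_self hp, if_neg (ne_nil_of_head? hp)]

theorem plainToList_sound (hp : IsRevChain E p) (h : plainToList E k A p y ≠ []) :
    IsExtension E A p (plainToList E k A p y) ∧ (plainToList E k A p y).head? = some y := by
  rw [plainToList] at h ⊢
  split at h
  · rename_i hc
    rw [if_pos hc]
    obtain ⟨x, hxy, hx, heq⟩ := endAtList_spec h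
    obtain ⟨hm, hh⟩ := findEndList_spec hx
    obtain ⟨w, hw, hwA, hch⟩ := closureList_sound hp hm
    rw [heq]
    exact ⟨⟨y :: w, by rw [hw]; rfl, hwA, hch.cons hh hxy⟩, rfl⟩
  · rename_i hc
    rw [if_neg hc]
    obtain ⟨hm, hh⟩ := findEndList_spec hc
    obtain ⟨w, hw, hwA, hch⟩ := closureList_sound hp hm
    exact ⟨⟨w, hw, fun z hz => hwA z (List.mem_of_mem_tail hz), hch⟩, hh⟩

theorem plainToList_ne_nil [Fintype V] (hk : Fintype.card V ≤ k)
    (hp : p.head? = some z) (hl : (z :: (l ++ [y])).IsChain fun a b => (a, b) ∈ E)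
    (hA : ∀ x ∈ l, x ∈ A) : plainToList E k A p y ≠ [] := by
  rw [plainToList]
  split
  · rw [← List.cons_append, List.isChain_append] at hl
    have h := findEndList_closureList_ne_nil hk hp hl.1 hA
    have hlast := List.getLast_mem (l := z :: l) (by simp)
    exact endAtList_ne_nil
      (hl.2.2 _ (List.getLast?_eq_some_getLast (by simp)) y (by simp)) (h _ hlast)
  · assumption

/-- If `v = y` then `v` need not be in `A`; it is then the last vertex, as the search returns a path
that already ends in its goal unchanged. -/
theorem throughToList_sound (hp : IsRevChain E p) (huv : (u, v) ∈ E)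
    (h : throughToList E k A p u v y ≠ []) :
    IsExtension E A p (throughToList E k A p u v y) ∧
      (throughToList E k A p u v y).head? = some y ∧
      [v, u] <:+: throughToList E k A p u v y := by
  rw [throughToList, continueToList] at h ⊢
  split at h
  swap
  · exact absurd rfl h
  rename_i hc
  rw [if_pos hc]
  obtain ⟨hm, hh⟩ := findEndList_spec hc.1
  obtain ⟨w, hw, hwA, hch⟩ := closureList_sound hp hm
  set q := findEndList u (closureList E k A p)
  have hvq := hch.cons hh huv
  obtain ⟨⟨w', hw', hw'A, hch'⟩, hhead⟩ := plainToList_sound hvq h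
  have hq : ∃ q', q = u :: q' := by
    rcases hq : q with _ | ⟨a, q'⟩
    · exact absurd hq hc.1
    · rw [hq] at hh
      exact ⟨q', by simpa using hh⟩
  refine ⟨?_, hhead, ?_⟩
  · rcases hc.2 with rfl | hv
    · rw [plainToList_self (by simp)]
      exact ⟨v :: w, by rw [hw]; rfl, hwA, hvq⟩
    · refine ⟨w' ++ v :: w, by rw [hw', hw]; simp, fun z hz => ?_, hch'⟩
      rcases w' with _ | ⟨a, w'⟩
      · exact hwA z hz
      · simp only [List.cons_append, List.tail_cons, List.mem_append, List.mem_cons] at hz hw'A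
        rcases hz with hz | rfl | hz
        · exact hw'A z hz
        · exact hv
        · exact hwA z hz
  · obtain ⟨q', hq'⟩ := hq
    rw [hw', hq']
    exact ⟨w', q', by simp⟩

theorem throughToList_ne_nil [Fintype V] (hk : Fintype.card V ≤ k)
    (hp : p.head? = some z) (hl : (z :: (l ++ [y])).IsChain fun a b => (a, b) ∈ E)
    (hA : ∀ x ∈ l, x ∈ A) (huv : [u, v] <:+: z :: (l ++ [y])) :
    throughToList E k A p u v y ≠ [] := by
  obtain ⟨α, β, hαβ⟩ := huv
  have hreach := findEndList_closureList_ne_nil hk hp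
    (by rw [← List.cons_append, List.isChain_append] at hl; exact hl.1) hA
  rw [throughToList, continueToList]
  rcases List.eq_nil_or_concat β with rfl | ⟨β, y', rfl⟩
  -- Either `(u, v)` is the last edge of the walk, or `v` is an inner vertex and `β` leads on from it.
  · have h' : (α ++ [u]) ++ [v] = (z :: l) ++ [y] := by simpa using hαβ
    obtain ⟨h₁, h₂⟩ := List.append_inj' h' rfl
    obtain rfl : v = y := by simpa using h₂
    rw [if_pos ⟨hreach u (by rw [← h₁]; simp), Or.inl rfl⟩, plainToList_self (by simp)]
    simp
  · have h' : (α ++ u :: v :: β) ++ [y'] = (z :: l) ++ [y] := by simpa using hαβ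
    obtain ⟨h₁, h₂⟩ := List.append_inj' h' rfl
    obtain rfl : y' = y := by simpa using h₂
    have hsub : ∀ x ∈ v :: β, x ∈ l := by
      intro x hx
      rcases α with _ | ⟨a, α⟩
      · simp only [List.nil_append, List.cons.injEq] at h₁
        rw [← h₁.2]
        exact hx
      · simp only [List.cons_append, List.cons.injEq] at h₁
        rw [← h₁.2]
        exact List.mem_append_right _ (List.mem_cons_of_mem _ hx)
    rw [List.forall_mem_cons] at hsub
    rw [if_pos ⟨hreach u (by rw [← h₁]; simp), Or.inr (hA v hsub.1)⟩]
    refine plainToList_ne_nil hk (z := v) (l := β) (by simp) ?_ fun x hx => hA x (hsub.2 x hx)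
    rw [← List.cons_append, ← h₁] at hl
    have : (α ++ u :: v :: β) ++ [y'] = (α ++ [u]) ++ (v :: (β ++ [y'])) := by simp
    rw [this, List.isChain_append] at hl
    exact hl.2.1

theorem segmentList_sound (hp : IsRevChain E p) (huv : (u, v) ∈ E)
    (h : segmentList E k A p u v y ≠ []) :
    IsExtension E A p (segmentList E k A p u v y) ∧
      (segmentList E k A p u v y).head? = some y := by
  rw [segmentList] at h ⊢
  split_ifs at h ⊢ with h₁ h₂
  · exact plainToList_sound hp h
  · exact plainToList_sound hp h
  · have := throughToList_sound hp huv h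
    exact ⟨this.1, this.2.1⟩

theorem segmentList_ne_nil [Fintype V] (hk : Fintype.card V ≤ k)
    (hp : p.head? = some z) (hl : (z :: (l ++ [y])).IsChain fun a b => (a, b) ∈ E)
    (hA : ∀ x ∈ l, x ∈ A) : segmentList E k A p u v y ≠ [] := by
  rw [segmentList]
  split_ifs with h₁ h₂
  · exact plainToList_ne_nil hk hp hl hA
  · exact plainToList_ne_nil hk hp hl hA
  · exact h₂

/-- If some walk to `y` through `A` contains the edge `(u, v)`, the segment that is chosen makes the
path contain it. -/
theorem infix_segmentList [Fintype V] (hk : Fintype.card V ≤ k)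
    (hpc : IsRevChain E p) (huvE : (u, v) ∈ E)
    (hp : p.head? = some z) (hl : (z :: (l ++ [y])).IsChain fun a b => (a, b) ∈ E)
    (hA : ∀ x ∈ l, x ∈ A) (huv : [v, u] <:+: p ∨ [u, v] <:+: z :: (l ++ [y])) :
    [v, u] <:+: segmentList E k A p u v y := by
  by_cases h : [v, u] <:+: p
  · obtain ⟨⟨w, hw, -⟩, -⟩ := segmentList_sound (k := k) hpc huvE
      (segmentList_ne_nil (u := u) (v := v) hk hp hl hA)
    rw [hw]
    exact h.trans (List.suffix_append _ _).isInfix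
  · have h' := throughToList_ne_nil hk hp hl hA (huv.resolve_left h)
    rw [segmentList, if_neg h, if_neg h']
    exact (throughToList_sound hpc huvE h').2.2

theorem finishList_sound (hp : IsRevChain E p) (huv : (u, v) ∈ E)
    (h : finishList E k A p u v y ≠ []) :
    IsExtension E A p (finishList E k A p u v y) ∧
      (finishList E k A p u v y).head? = some y ∧ [v, u] <:+: finishList E k A p u v y := by
  rw [finishList] at h ⊢
  split_ifs at h ⊢ with h₁
  · obtain ⟨⟨w, hw, hA⟩, hh⟩ := plainToList_sound hp h
    refine ⟨⟨w, hw, hA⟩, hh, ?_⟩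
    rw [hw]
    exact h₁.trans (List.suffix_append _ _).isInfix
  · exact throughToList_sound hp huv h

theorem finishList_ne_nil [Fintype V] (hk : Fintype.card V ≤ k)
    (hp : p.head? = some z) (hl : (z :: (l ++ [y])).IsChain fun a b => (a, b) ∈ E)
    (hA : ∀ x ∈ l, x ∈ A) (huv : [v, u] <:+: p ∨ [u, v] <:+: z :: (l ++ [y])) :
    finishList E k A p u v y ≠ [] := by
  rw [finishList]
  split_ifs with h₁
  · exact plainToList_ne_nil hk hp hl hA
  · exact throughToList_ne_nil hk hp hl hA (huv.resolve_left h₁)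

end

/-! ### Sequences of critical vertices and proper paths -/

section
variable {V : Type} [DecidableEq V]

theorem mem_criticalList {C : List (V × V)} {z : V} :
    z ∈ criticalList C ↔ ∃ e ∈ C, z = e.1 ∨ z = e.2 := by
  induction C with
  | nil => simp [criticalList]
  | cons c C ih => simp [criticalList, ih, or_assoc]

theorem nodup_criticalList (C : List (V × V)) : (criticalList C).Nodup := by
  induction C with
  | nil => simp [criticalList]
  | cons c C ih => exact (ih.insert).insert

theorem mem_insertionsList {W : Type} {x : W} {d d' : List W} :
    d' ∈ insertionsList x d ↔ ∃ a b, d = a ++ b ∧ d' = a ++ x :: b := by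
  induction d generalizing d' with
  | nil => simp [insertionsList]
  | cons z d ih =>
    simp only [insertionsList, List.mem_cons, List.mem_map, ih]
    constructor
    · rintro (rfl | ⟨_, ⟨a, b, rfl, rfl⟩, rfl⟩)
      · exact ⟨[], z :: d, rfl, rfl⟩
      · exact ⟨z :: a, b, rfl, rfl⟩
    · rintro ⟨a, b, h, rfl⟩
      rcases a with _ | ⟨z', a⟩
      · simp only [List.nil_append] at h
        simp [h]
      · simp only [List.cons_append, List.cons.injEq] at h
        obtain ⟨rfl, rfl⟩ := h
        exact Or.inr ⟨_, ⟨a, b, rfl, rfl⟩, rfl⟩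

theorem mem_extendAllList {W : Type} {x : W} {D : List (List W)} {d' : List W} :
    d' ∈ extendAllList x D ↔ ∃ d ∈ D, d' = d ∨ d' ∈ insertionsList x d := by
  induction D with
  | nil => simp [extendAllList]
  | cons d D ih => simp [extendAllList, ih, or_assoc]

theorem mem_sequencesList {W : Type} {L c : List W} (hL : L.Nodup) :
    c ∈ sequencesList L ↔ c.Nodup ∧ c ⊆ L := by
  induction L generalizing c with
  | nil => simp +contextual [sequencesList]
  | cons x L ih =>
    rw [List.nodup_cons] at hL
    simp only [sequencesList, mem_extendAllList, ih hL.2]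
    constructor
    · rintro ⟨d, ⟨hd, hdL⟩, rfl | h⟩
      · exact ⟨hd, fun z hz => List.mem_cons_of_mem _ (hdL hz)⟩
      · obtain ⟨a, b, rfl, rfl⟩ := mem_insertionsList.1 h
        refine ⟨List.nodup_middle.2 (List.nodup_cons.2 ⟨fun hx => hL.1 (hdL hx), hd⟩), ?_⟩
        intro z hz
        rcases List.mem_cons.1 (List.perm_middle.mem_iff.1 hz) with rfl | hz
        · simp
        · exact List.mem_cons_of_mem _ (hdL hz)
    · rintro ⟨hc, hcL⟩
      by_cases hx : x ∈ c
      · obtain ⟨a, b, rfl⟩ := List.append_of_mem hx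
        rw [List.nodup_middle, List.nodup_cons] at hc
        refine ⟨a ++ b, ⟨hc.2, fun z hz => ?_⟩, Or.inr (mem_insertionsList.2 ⟨a, b, rfl, rfl⟩)⟩
        have hz' : z ∈ a ++ x :: b :=
          List.perm_middle.mem_iff.2 (List.mem_cons_of_mem _ hz)
        rcases List.mem_cons.1 (hcL hz') with rfl | h
        · exact absurd hz hc.1
        · exact h
      · refine ⟨c, ⟨hc, fun z hz => ?_⟩, Or.inl rfl⟩
        rcases List.mem_cons.1 (hcL hz) with rfl | h
        · exact absurd hz hx
        · exact h

theorem length_le_of_mem_sequencesList {W : Type} {L c : List W} (h : c ∈ sequencesList L) :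
    c.length ≤ L.length := by
  induction L generalizing c with
  | nil =>
    obtain rfl : c = [] := by simpa [sequencesList] using h
    simp
  | cons x L ih =>
    obtain ⟨d, hd, rfl | hc⟩ := mem_extendAllList.1 h
    · exact (ih hd).trans (by simp)
    · obtain ⟨a, b, rfl, rfl⟩ := mem_insertionsList.1 hc
      have := ih hd
      simp only [List.length_append, List.length_cons] at this ⊢
      omega

theorem length_extendAllList_le {W : Type} (x : W) {D : List (List W)} {b : ℕ}
    (h : ∀ d ∈ D, d.length ≤ b) : (extendAllList x D).length ≤ (b + 2) * D.length := by
  induction D with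
  | nil => simp [extendAllList]
  | cons d D ih =>
    rw [List.forall_mem_cons] at h
    have := ih h.2
    simp only [extendAllList, List.length_cons, List.length_append, length_insertionsList]
    linarith [h.1]

/-- A sequence of length at most `b` has at most `b + 1` results of an insertion, so that one more
element multiplies the number of sequences by at most `b + 2`. -/
theorem length_sequencesList_le {W : Type} (L : List W) :
    (sequencesList L).length ≤ (L.length + 1).factorial := by
  induction L with
  | nil => simp [sequencesList]
  | cons x L ih =>
    have := length_extendAllList_le x fun d (hd : d ∈ sequencesList L) =>
      length_le_of_mem_sequencesList hd
    simp only [sequencesList, List.length_cons]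
    rw [Nat.factorial_succ (L.length + 1)]
    exact this.trans (Nat.mul_le_mul_left _ ih)

end

section
variable {W : Type} {x y : W} {l : List W}

theorem pair_sublist_or (hxy : x ≠ y) (hx : x ∈ l) (hy : y ∈ l) :
    [x, y].Sublist l ∨ [y, x].Sublist l := by
  obtain ⟨a, b, rfl⟩ := List.append_of_mem hx
  rcases List.mem_append.1 hy with h | h
  · exact Or.inr ((List.singleton_sublist.2 h).append (List.singleton_sublist.2 (by simp)))
  · have h' : y ∈ b := by simpa [hxy.symm] using h
    exact Or.inl (((List.singleton_sublist.2 h').cons_cons x).trans (List.sublist_append_right a _))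

theorem not_pair_sublist_swap (hl : l.Nodup) (h : [x, y].Sublist l) : ¬ [y, x].Sublist l := by
  intro h'
  induction l with
  | nil => simp at h
  | cons a l ih =>
    rw [List.nodup_cons] at hl
    rw [List.cons_sublist_cons'] at h h'
    rcases h with h | ⟨rfl, h⟩
    · rcases h' with h' | ⟨rfl, -⟩
      · exact ih hl.2 h h'
      · exact hl.1 (h.subset (by simp))
    · rcases h' with h' | ⟨rfl, h'⟩
      · exact hl.1 (h'.subset (by simp))
      · exact hl.1 (h.subset (by simp))

theorem pair_infix_append_cons {u v y : W} {a b : List W} (h : [u, v] <:+: a ++ y :: b) :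
    [u, v] <:+: a ++ [y] ∨ [u, v] <:+: y :: b := by
  induction a with
  | nil => exact Or.inr h
  | cons c a ih =>
    rw [List.cons_append, List.infix_cons_iff] at h
    rcases h with h | h
    · left
      refine List.IsPrefix.isInfix ?_
      rcases a with _ | ⟨c', a⟩
      · simpa [List.cons_prefix_cons] using h
      · simpa [List.cons_prefix_cons] using h
    · refine (ih h).imp_left fun h' => ?_
      exact List.infix_cons h'

variable [DecidableEq W] {q : W → Prop} [DecidablePred q] {r : List W}

/-- If `y` is the first element of a sequence ordered by last occurrences in `l`, then the rest of
the sequence lists what follows the last occurrence of `y`. -/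
theorem exists_of_dedup_filter_eq_cons (h : (l.filter q).dedup = y :: r) :
    ∃ l₁ l₂, l = l₁ ++ y :: l₂ ∧ (l₂.filter q).dedup = r := by
  induction l with
  | nil => simp at h
  | cons a l ih =>
    by_cases ha : q a
    · rw [List.filter_cons_of_pos (by simpa using ha)] at h
      by_cases hm : a ∈ l.filter q
      · rw [List.dedup_cons_of_mem hm] at h
        obtain ⟨l₁, l₂, rfl, h₂⟩ := ih h
        exact ⟨a :: l₁, l₂, rfl, h₂⟩
      · rw [List.dedup_cons_of_notMem hm, List.cons.injEq] at h
        exact ⟨[], l, by rw [h.1]; rfl, h.2⟩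
    · rw [List.filter_cons_of_neg (by simpa using ha)] at h
      obtain ⟨l₁, l₂, rfl, h₂⟩ := ih h
      exact ⟨a :: l₁, l₂, rfl, h₂⟩

end

section
variable {V : Type} [DecidableEq V] {C : List (V × V)}

/-- In an admissible sequence no constraint is violated by the order of the elements: `x` before `y`
with `(x, y)` in `C` would put `y` before `x`, too. -/
theorem Admissible.pairwise {U : Type} {C : List (U × U)} {c : List U} (h : Admissible C c) (hc : c.Nodup) :
    c.Pairwise fun x y => (x, y) ∉ C := by
  refine List.pairwise_iff_forall_sublist.2 fun {x y} hxy hC => ?_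
  have hne : x ≠ y := by
    have := hc.sublist hxy
    simpa using this
  have := h (x, y) hC hne (hxy.subset (by simp)) (hxy.subset (by simp))
  exact not_pair_sublist_swap hc hxy this

/-- An extension of a path that respects the constraints respects them, too, provided that its
new vertices are taken from the part `r` of the sequence not yet reached and that no vertex before
them demands their absence. -/
theorem not_sublist_append {w p r : List V}
    (hw : ∀ z ∈ w, z ∈ criticalList C → z ∈ r)
    (hwt : ∀ z ∈ w.tail, Available C z r)
    (hpr : ∀ e ∈ C, e.1 ∈ p → e.2 ∉ r) (hp : ∀ e ∈ C, ¬ [e.2, e.1].Sublist p) :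
    ∀ e ∈ C, ¬ [e.2, e.1].Sublist (w ++ p) := by
  intro e he h
  have h₁ : e.1 ∈ criticalList C := mem_criticalList.2 ⟨e, he, Or.inl rfl⟩
  have h₂ : e.2 ∈ criticalList C := mem_criticalList.2 ⟨e, he, Or.inr rfl⟩
  obtain ⟨l₁, l₂, hl, hl₁, hl₂⟩ := List.sublist_append_iff.1 h
  rcases l₁ with _ | ⟨b, _ | ⟨a, l₁⟩⟩
  · rw [List.nil_append] at hl
    exact hp e he (hl ▸ hl₂)
  -- The vertex `e.1` is on `p` and `e.2` is new.
  · simp only [List.cons_append, List.nil_append, List.cons.injEq] at hl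
    obtain ⟨rfl, rfl⟩ := hl
    exact hpr e he (List.singleton_sublist.1 hl₂) (hw _ (List.singleton_sublist.1 hl₁) h₂)
  -- Both vertices are new; then `e.1` is not the last vertex, and it is blocked by `e.2`.
  · simp only [List.cons_append, List.cons.injEq] at hl
    obtain ⟨rfl, rfl, -⟩ := hl
    rcases w with _ | ⟨y, w⟩
    · simp at hl₁
    · have ha : e.1 ∈ w := (List.Sublist.tail hl₁).subset (by simp)
      exact (hwt _ ha h₁).2 ⟨e, he, rfl, hw _ (hl₁.subset (by simp)) h₂⟩

end

namespace PresentedCCFG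

variable {I : PresentedCCFG} {u v : Fin I.n} {c r p q : List (Fin I.n)}

theorem mem_allowed {x : Fin I.n} : x ∈ I.allowed r ↔ Available I.constraints x r := by
  simp [allowed]

theorem walk_nil : I.walk u v r [] = [] := by
  cases r <;> simp [walk]

/-- No edge enters the source. -/
theorem eq_singleton_of_head?_eq_s (hq : IsRevChain I.edges q) (h : q.head? = some I.G.s) :
    q = [I.G.s] := by
  rcases q with _ | ⟨a, _ | ⟨b, q⟩⟩
  · simp at h
  · simpa using h
  · obtain rfl : a = I.G.s := by simpa using h
    exact absurd ((I.mem_edges _).1 (List.isChain_cons_cons.1 hq).1) (I.G.no_edge_into_s _)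

/-- No edge leaves the sink. -/
theorem eq_nil_of_t_mem {w : List (Fin I.n)} (hq : IsRevChain I.edges (w ++ p))
    (ht : I.G.t ∈ p) : w = [] := by
  by_contra hw
  obtain ⟨a, b, rfl⟩ := List.append_of_mem ht
  rw [← List.append_assoc] at hq
  have h := (List.isChain_append.1 hq).2.2 _
    (List.getLast?_eq_some_getLast (List.append_ne_nil_of_left_ne_nil hw a)) I.G.t (by simp)
  exact I.G.no_edge_from_t _ ((I.mem_edges _).1 h)

/-- Once the source has been left, a sequence that still contains it cannot be completed. -/
theorem walk_eq_nil (huv : (u, v) ∈ I.edges) (hp : IsRevChain I.edges p) (hlen : 2 ≤ p.length)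
    (hs : I.G.s ∈ r) : I.walk u v r p = [] := by
  induction r generalizing p with
  | nil => simp at hs
  | cons y r ih =>
    rw [walk]
    split
    · rfl
    by_cases hq : segmentList I.edges I.n (I.allowed (y :: r)) p u v y = []
    · rw [hq, walk_nil]
    obtain ⟨⟨w, hw, -, hch⟩, hh⟩ := segmentList_sound hp huv hq
    have hlen' : 2 ≤ (segmentList I.edges I.n (I.allowed (y :: r)) p u v y).length := by
      rw [hw, List.length_append]
      omega
    refine ih hch hlen' ((List.mem_cons.1 hs).resolve_left ?_)
    rintro rfl
    rw [eq_singleton_of_head?_eq_s hch hh] at hlen'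
    simp at hlen'

variable (I) in
/-- The reversed path `q` is a test path that respects the constraints. -/
structure IsGood (q : List (Fin I.n)) : Prop where
  chain : IsRevChain I.edges q
  head : q.head? = some I.G.t
  last : q.getLast? = some I.G.s
  respects : ∀ e ∈ I.constraints, ¬ [e.2, e.1].Sublist q

/-- The invariant of the loop: the path respects the constraints, and for no constraint `(x, y)` has
it visited `x` while `y` is still to be reached. The sink is either on the path or still to be
reached, so that the last segment does not add a constrained vertex. -/
theorem walk_sound (huv : (u, v) ∈ I.edges) (hp : IsRevChain I.edges p)
    (hlast : p.getLast? = some I.G.s)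
    (hr : r.Pairwise fun x y => (x, y) ∉ I.constraints)
    (ht : I.G.t ∈ criticalList I.constraints → I.G.t ∈ p ∨ I.G.t ∈ r)
    (hpr : ∀ e ∈ I.constraints, e.1 ∈ p → e.2 ∉ r)
    (hresp : ∀ e ∈ I.constraints, ¬ [e.2, e.1].Sublist p)
    (h : I.walk u v r p ≠ []) :
    I.IsGood (I.walk u v r p) ∧ [v, u] <:+: I.walk u v r p := by
  have hp₀ : p ≠ [] := by
    rintro rfl
    simp at hlast
  induction r generalizing p with
  | nil =>
    rw [walk, if_neg hp₀] at h ⊢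
    obtain ⟨⟨w, hw, hwA, hch⟩, hh, huv'⟩ := finishList_sound hp huv h
    refine ⟨⟨hch, hh, ?_, ?_⟩, huv'⟩
    · rw [hw, List.getLast?_append_of_ne_nil _ hp₀, hlast]
    rw [hw] at hch hh ⊢
    have hwA' : ∀ z ∈ w.tail, Available I.constraints z [] := fun z hz => mem_allowed.1 (hwA z hz)
    refine not_sublist_append (fun z hz hzc => ?_) hwA' hpr hresp
    rcases w with _ | ⟨y, w⟩
    · simp at hz
    · obtain rfl : y = I.G.t := by simpa using hh
      rcases List.mem_cons.1 hz with rfl | hz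
      · -- A constrained sink is already on the path, so nothing has been added to it.
        have := eq_nil_of_t_mem hch ((ht hzc).resolve_right (by simp))
        simp at this
      · exact (hwA' z hz hzc).1
  | cons y r ih =>
    rw [walk, if_neg hp₀] at h ⊢
    have hq : segmentList I.edges I.n (I.allowed (y :: r)) p u v y ≠ [] := by
      intro hq
      rw [hq, walk_nil] at h
      exact h rfl
    obtain ⟨⟨w, hw, hwA, hch⟩, hh⟩ := segmentList_sound hp huv hq
    have hwA' : ∀ z ∈ w.tail, Available I.constraints z (y :: r) :=
      fun z hz => mem_allowed.1 (hwA z hz)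
    rw [List.pairwise_cons] at hr
    have hwy : ∀ z ∈ w, z = y ∨ z ∈ w.tail := by
      intro z hz
      rcases w with _ | ⟨a, w⟩
      · simp at hz
      · obtain rfl : a = y := by simpa [hw] using hh
        simpa using hz
    refine ih hch ?_ hr.2 (fun htc => ?_) (fun e he h₁ h₂ => ?_) ?_ h hq
    · rw [hw, List.getLast?_append_of_ne_nil _ hp₀, hlast]
    · rcases ht htc with ht | ht
      · left
        rw [hw]
        exact List.mem_append_right _ ht
      · rcases List.mem_cons.1 ht with rfl | ht
        · exact Or.inl (List.mem_of_mem_head? hh)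
        · exact Or.inr ht
    · rw [hw, List.mem_append] at h₁
      rcases h₁ with h₁ | h₁
      · rcases hwy _ h₁ with h₁ | h₁
        · exact hr.1 _ h₂ (h₁ ▸ he)
        · exact (hwA' _ h₁ (mem_criticalList.2 ⟨e, he, Or.inl rfl⟩)).2
            ⟨e, he, rfl, List.mem_cons_of_mem _ h₂⟩
      · exact hpr e he h₁ (List.mem_cons_of_mem _ h₂)
    · rw [hw]
      refine not_sublist_append (fun z hz hzc => ?_) hwA' hpr hresp
      rcases hwy z hz with rfl | hz
      · simp
      · exact (hwA' z hz hzc).1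

/-- The source needs special care. If it is in the sequence then it has to be the first element, as
the loop cannot return to it; it has then been dealt with after the first segment. -/
theorem properPath_sound (huv : (u, v) ∈ I.edges) (hc : c.Nodup)
    (hadm : Admissible I.constraints c) (h : I.properPath c u v ≠ []) :
    I.IsGood (I.properPath c u v) ∧ [v, u] <:+: I.properPath c u v := by
  have hpw := hadm.pairwise hc
  have hs₁ : IsRevChain I.edges [I.G.s] := List.isChain_singleton _
  have hresp : ∀ e ∈ I.constraints, ¬ [e.2, e.1].Sublist [I.G.s] :=
    fun e _ h => by simpa using h.length_le
  rw [properPath] at h ⊢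
  split at h
  swap
  · exact absurd rfl h
  rename_i hok
  rw [if_pos hok]
  by_cases hs : I.G.s ∈ c
  · rcases c with _ | ⟨y, c⟩
    · simp at hs
    rw [walk, if_neg (by simp)] at h ⊢
    have hq : segmentList I.edges I.n (I.allowed (y :: c)) [I.G.s] u v y ≠ [] := by
      intro hq
      rw [hq, walk_nil] at h
      exact h rfl
    obtain ⟨⟨w, hw, -, hch⟩, hh⟩ := segmentList_sound hs₁ huv hq
    by_cases hys : y = I.G.s
    · subst hys
      rw [eq_singleton_of_head?_eq_s hch hh] at h ⊢
      rw [List.pairwise_cons] at hpw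
      refine walk_sound huv hs₁ rfl hpw.2 (fun ht => Or.inr ?_) (fun e he h₁ h₂ => ?_) hresp h
      · exact (List.mem_cons.1 (hok.2 ht)).resolve_left I.G.s_ne_t.symm
      · rw [List.mem_singleton] at h₁
        exact hpw.1 _ h₂ (h₁ ▸ he)
    · refine absurd (walk_eq_nil huv hch ?_ ((List.mem_cons.1 hs).resolve_left (Ne.symm hys))) h
      rcases w with _ | ⟨a, w⟩
      · rw [hw] at hh
        simp [Ne.symm hys] at hh
      · rw [hw]
        simp
  · refine walk_sound huv hs₁ rfl hpw (fun ht => Or.inr (hok.2 ht)) (fun e he h₁ _ => ?_) hresp h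
    rw [List.mem_singleton] at h₁
    exact hs (hok.1 (mem_criticalList.2 ⟨e, he, Or.inl h₁.symm⟩))

/-- The loop succeeds if a path that respects the constraints leads on from the end `z` of `p` to
the sink, and `r` lists the constrained vertices of its rest `σ` by last occurrence. Each segment
of the given path, from one such last occurrence to the next, shows that the loop can find one. -/
theorem walk_ne_nil {z : Fin I.n} {σ : List (Fin I.n)} (huvE : (u, v) ∈ I.edges)
    (hz : p.head? = some z) (hp : IsRevChain I.edges p)
    (hσ : (z :: σ).IsChain fun a b => (a, b) ∈ I.edges)
    (hlast : (z :: σ).getLast? = some I.G.t)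
    (hresp : ∀ e ∈ I.constraints, ¬ [e.1, e.2].Sublist σ)
    (hr : (σ.filter (· ∈ criticalList I.constraints)).dedup = r)
    (huv : [v, u] <:+: p ∨ [u, v] <:+: z :: σ) : I.walk u v r p ≠ [] := by
  have hn : Fintype.card (Fin I.n) ≤ I.n := (Fintype.card_fin _).le
  induction r generalizing p z σ with
  | nil =>
    rw [walk, if_neg (ne_nil_of_head? hz)]
    rcases List.eq_nil_or_concat' σ with rfl | ⟨σ, y, rfl⟩
    · obtain rfl : z = I.G.t := by simpa using hlast
      have h : [v, u] <:+: p := huv.resolve_right fun h => by simpa using h.length_le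
      rw [finishList, if_pos h, plainToList_self hz]
      exact ne_nil_of_head? hz
    · obtain rfl : y = I.G.t := by
        rw [List.getLast?_cons] at hlast
        simpa using hlast
      refine finishList_ne_nil hn hz hσ (fun x hx => mem_allowed.2 fun hxc => ?_) huv
      have : x ∈ ((σ ++ [I.G.t]).filter (· ∈ criticalList I.constraints)).dedup := by
        simp [hx, hxc]
      rw [hr] at this
      simp at this
  | cons y r ih =>
    rw [walk, if_neg (ne_nil_of_head? hz)]
    obtain ⟨σ₁, σ₂, rfl, hr₂⟩ := exists_of_dedup_filter_eq_cons hr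
    have hsplit : z :: (σ₁ ++ y :: σ₂) = (z :: (σ₁ ++ [y])) ++ σ₂ := by simp
    have hσ₁ : (z :: (σ₁ ++ [y])).IsChain fun a b => (a, b) ∈ I.edges := by
      rw [hsplit] at hσ
      exact (List.isChain_append.1 hσ).1
    have hσ₂ : (y :: σ₂).IsChain fun a b => (a, b) ∈ I.edges := by
      rw [← List.cons_append] at hσ
      exact (List.isChain_append.1 hσ).2.1
    have hA : ∀ x ∈ σ₁, x ∈ I.allowed (y :: r) := by
      refine fun x hx => mem_allowed.2 fun hxc => ⟨?_, ?_⟩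
      · rw [← hr]
        simp [hx, hxc]
      · rintro ⟨e, he, rfl, h₂⟩
        refine hresp e he ((List.singleton_sublist.2 hx).append (List.singleton_sublist.2 ?_))
        rcases List.mem_cons.1 h₂ with h₂ | h₂
        · simp [h₂]
        · rw [← hr₂, List.mem_dedup, List.mem_filter] at h₂
          exact List.mem_cons_of_mem _ h₂.1
    have hne := segmentList_ne_nil (u := u) (v := v) hn hz hσ₁ hA
    obtain ⟨⟨w, hw, -, hch⟩, hh⟩ := segmentList_sound hp huvE hne
    refine ih hh hch hσ₂ ?_ (fun e he h => hresp e he (h.trans ?_)) hr₂ ?_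
    · rw [← hlast, ← List.cons_append, List.getLast?_append_of_ne_nil _ (by simp)]
    · exact (List.sublist_cons_self _ _).trans (List.sublist_append_right _ _)
    · rcases huv with huv | huv
      · exact Or.inl (infix_segmentList hn hp huvE hz hσ₁ hA (Or.inl huv))
      · rw [← List.cons_append] at huv
        rcases pair_infix_append_cons huv with h | h
        · exact Or.inl (infix_segmentList hn hp huvE hz hσ₁ hA (Or.inr h))
        · exact Or.inr h

/-- For a test path that respects the constraints, its constrained vertices in the order of their
last occurrences form an admissible sequence, with which a proper path through any edge of the test
path is found. (`List.dedup` keeps last occurrences.) -/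
theorem exists_properPath_ne_nil {π : List (Fin I.n)} (huvE : (u, v) ∈ I.edges)
    (hπ : π.IsChain fun a b => (a, b) ∈ I.edges) (hhead : π.head? = some I.G.s)
    (hlast : π.getLast? = some I.G.t)
    (hresp : ∀ e ∈ I.constraints, ¬ [e.1, e.2].Sublist π) (huv : [u, v] <:+: π) :
    ∃ c ∈ sequencesList (criticalList I.constraints),
      Admissible I.constraints c ∧ I.properPath c u v ≠ [] := by
  set c := (π.filter (· ∈ criticalList I.constraints)).dedup with hc
  have hmem : ∀ x, x ∈ c ↔ x ∈ π ∧ x ∈ criticalList I.constraints := by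
    simp [hc]
  have hsub : c.Sublist π := (List.dedup_sublist _).trans List.filter_sublist
  refine ⟨c, (mem_sequencesList (nodup_criticalList _)).2
    ⟨List.nodup_dedup _, fun x hx => ((hmem x).1 hx).2⟩, fun e he hne h₁ h₂ => ?_, ?_⟩
  · exact (pair_sublist_or hne h₁ h₂).resolve_left fun h => hresp e he (h.trans hsub)
  · have hok : I.InitOk I.G.s c ∧ I.InitOk I.G.t c :=
      ⟨fun h => (hmem _).2 ⟨List.mem_of_mem_head? hhead, h⟩,
        fun h => (hmem _).2 ⟨List.mem_of_mem_getLast? hlast, h⟩⟩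
    rw [properPath, if_pos hok]
    rcases π with _ | ⟨s', σ⟩
    · simp at hhead
    obtain rfl : s' = I.G.s := by simpa using hhead
    have hs₁ : IsRevChain I.edges [I.G.s] := List.isChain_singleton _
    have hresp' : ∀ e ∈ I.constraints, ¬ [e.1, e.2].Sublist σ :=
      fun e he h => hresp e he (h.trans (List.sublist_cons_self _ _))
    -- The source occurs only once: if it is constrained, it is the first element of the sequence.
    have hwalk : ∀ r, (σ.filter (· ∈ criticalList I.constraints)).dedup = r →
        I.walk u v r [I.G.s] ≠ [] := fun r hr =>
      walk_ne_nil huvE rfl hs₁ hπ hlast hresp' hr (Or.inr huv)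
    by_cases hs : I.G.s ∈ criticalList I.constraints
    · have hσ : I.G.s ∉ σ := by
        intro h
        obtain ⟨a, b, rfl⟩ := List.append_of_mem h
        rw [← List.cons_append] at hπ
        have h' := (List.isChain_append.1 hπ).2.2 _
          (List.getLast?_eq_some_getLast (by simp)) I.G.s (by simp)
        exact I.G.no_edge_into_s _ ((I.mem_edges _).1 h')
      rw [hc, List.filter_cons_of_pos (by simpa using hs),
        List.dedup_cons_of_notMem (by simp [hσ]), walk, if_neg (by simp)]
      have hseg : segmentList I.edges I.n (I.allowed (I.G.s :: (σ.filter
          (· ∈ criticalList I.constraints)).dedup)) [I.G.s] u v I.G.s ≠ [] := by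
        rw [segmentList]
        split_ifs with h₁ h₂
        · rw [plainToList_self rfl]
          simp
        · rw [plainToList_self rfl]
          simp
        · exact h₂
      obtain ⟨⟨w, hw, -, hch⟩, hh⟩ := segmentList_sound hs₁ huvE hseg
      rw [eq_singleton_of_head?_eq_s hch hh]
      exact hwalk _ rfl
    · rw [hc, List.filter_cons_of_neg (by simpa using hs)]
      exact hwalk _ rfl

end PresentedCCFG

/-! ### The main loops and the running time -/

theorem run_sequences (L : List (Fin n)) (hL : (L.length + 1).factorial < M) :
    Runs .sequences [encL L] (encP (sequencesList L)) (200 * M ^ 4) := by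
  have hlt := (Nat.self_le_factorial (L.length + 1)).trans_lt hL
  suffices h : Runs .sequences [encL L] (encP (sequencesList L))
      ((L.length + 1) * (200 * M ^ 3)) from
    h.mono ((loop_le (M := M) (by omega) _).trans_eq (by ring))
  have hM : 1 ≤ M := by omega
  have hM' : 1 ≤ M ^ 3 := Nat.one_le_pow _ _ hM
  induction L with
  | nil =>
    simp [runs_iff, algorithmBody, sequencesList]
    linarith
  | cons a L ih =>
    simp only [List.length_cons] at hL hlt
    have hL' : (L.length + 1).factorial < M := (Nat.factorial_le (by omega)).trans_lt hL
    simp only [runs_iff, algorithmBody]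
    simp
    refine (ih hL' (by omega)).bind fun t ht => ?_
    refine (run_extendAll _ _ ((length_sequencesList_le L).trans_lt hL')
      fun d hd => (length_le_of_mem_sequencesList hd).trans_lt (by omega)).bind fun t₁ ht₁ => ?_
    simp [sequencesList]
    linarith

namespace PresentedCCFG

variable {I : PresentedCCFG}

theorem length_properPath_lt (hM : I.Fits M) {c : List (Fin I.n)}
    (hc : c.length ≤ 2 * I.constraints.length) (u v : Fin I.n) :
    (I.properPath c u v).length < M :=
  (length_properPath_le c u v).trans_lt
    ((Nat.add_le_add_left (Nat.mul_le_mul_right _ (by omega)) 1).trans_lt hM.path)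

/-- The loop over the edges adds to `T` good paths only, and it covers each of the given edges for
which a proper path exists. -/
theorem exists_run_whileEdges (hM : I.Fits M) {c : List (Fin I.n)}
    (hc : c.length ≤ 2 * I.constraints.length) (hnd : c.Nodup)
    (hadm : Admissible I.constraints c) (E : List (Fin I.n × Fin I.n))
    (hE : E ⊆ I.edges) (hlen : E.length < M) (T : List (List (Fin I.n))) :
    ∃ T', Runs .whileEdges [I.enc, encL c, encE E, encP T] (encP T')
        ((E.length + 1) * (6000 * M ^ 4)) ∧
      T'.length ≤ T.length + E.length ∧ T ⊆ T' ∧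
      (∀ p ∈ T', p ∈ T ∨ I.IsGood p ∧ p.length < M) ∧
      ∀ e ∈ E, I.properPath c e.1 e.2 ≠ [] → ∃ p ∈ T', [e.2, e.1] <:+: p := by
  obtain ⟨h₁, h₂, h₃, h₄⟩ := pow_chain hM.one_le
  have h₀ := hM.one_le
  induction hk : E.length using Nat.strong_induction_on generalizing E T with
  | _ k ih =>
    subst hk
    rcases E with _ | ⟨e, E⟩
    · refine ⟨T, ?_, by simp, by simp, fun p hp => Or.inl hp, by simp⟩
      simp [runs_iff, algorithmBody]
      linarith
    have he : (e.1, e.2) ∈ I.edges := hE (by simp)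
    -- A path that is found covers `e`, so that in both cases fewer edges are left.
    by_cases hp : I.properPath c e.1 e.2 = []
    · obtain ⟨T', hrun, hlen', hsub, hgood, hcov⟩ := ih E.length (by simp) E
        (fun x hx => hE (List.mem_cons_of_mem _ hx)) (by simp at hlen; omega) T rfl
      refine ⟨T', ?_, by simp; omega, hsub, hgood, ?_⟩
      · simp only [runs_iff, algorithmBody]
        simp
        refine (run_findProperPath hM hc).bind fun t ht => ?_
        -- `update` is called from here only and has no lemma of its own.
        change Wp _ (algorithmBody .update) _
        simp [algorithmBody, hp]
        refine hrun.bind fun t₁ ht₁ => ?_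
        simp
        linarith
      · intro e' he' hne
        rcases List.mem_cons.1 he' with rfl | he'
        · exact absurd hp hne
        · exact hcov e' he' hne
    · obtain ⟨hg, hcov₀⟩ := properPath_sound he hnd hadm hp
      have hplen := length_properPath_lt hM hc e.1 e.2
      set p := I.properPath c e.1 e.2 with hpdef
      have hlt : (minusPathList (e :: E) p).length < (e :: E).length :=
        List.length_filter_lt_length_iff_exists.2 ⟨e, by simp, by simpa using hcov₀⟩
      obtain ⟨T', hrun, hlen', hsub, hgood, hcov⟩ := ih _ hlt (minusPathList (e :: E) p)
        (fun x hx => hE (List.mem_of_mem_filter hx)) (hlt.trans hlen) (p :: T) rfl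
      rw [List.cons_subset] at hsub
      refine ⟨T', ?_, by simp only [List.length_cons] at hlen' hlt ⊢; omega, hsub.2, ?_, ?_⟩
      · simp only [runs_iff, algorithmBody]
        simp
        refine (run_findProperPath hM hc).bind fun t ht => ?_
        -- `update` is called from here only and has no lemma of its own.
        change Wp _ (algorithmBody .update) _
        rw [← hpdef]
        simp [algorithmBody, hp]
        have hminus := run_minusPath (e :: E) p hlen hplen
        rw [encE_cons] at hminus
        refine hminus.bind fun t₁ ht₁ => ?_
        rw [← encP_cons]
        refine hrun.bind fun t₂ ht₂ => ⟨rfl, ?_⟩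
        simp only [List.length_cons] at hlt
        have := ht₂.trans (Nat.mul_le_mul_right _ hlt)
        linarith
      · intro q hq
        rcases hgood q hq with h | h
        · rcases List.mem_cons.1 h with rfl | h
          · exact Or.inr ⟨hg, hplen⟩
          · exact Or.inl h
        · exact Or.inr h
      · intro e' he' hne
        by_cases hin : [e'.2, e'.1] <:+: p
        · exact ⟨p, hsub.1, hin⟩
        · exact hcov e' (List.mem_filter.2 ⟨he', by simpa using hin⟩) hne

/-- The answer "true" is correct because all paths in `T` are good; the answer "false" is given
only if for some edge no sequence in `S` leads to a proper path. -/
theorem exists_run_forSequences (hM : I.Fits M) (S : List (List (Fin I.n)))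
    (hS : ∀ c ∈ S, c.Nodup ∧ c.length ≤ 2 * I.constraints.length)
    (T : List (List (Fin I.n))) (hT : T.length + S.length * I.edges.length < M)
    (hgood : ∀ p ∈ T, I.IsGood p ∧ p.length < M) :
    ∃ b, Runs .forSequences [I.enc, encP S, encP T] (encB b)
        ((S.length + 1) * (8000 * M ^ 5)) ∧
      (b = true → ∀ e ∈ I.edges, ∃ p, I.IsGood p ∧ [e.2, e.1] <:+: p) ∧
      (b = false → ∃ e ∈ I.edges, (¬ ∃ p ∈ T, [e.2, e.1] <:+: p) ∧
        ∀ c ∈ S, Admissible I.constraints c → I.properPath c e.1 e.2 = []) := by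
  obtain ⟨h₁, h₂, h₃, h₄⟩ := pow_chain hM.one_le
  have h₀ := hM.one_le
  have hC : I.constraints.length < M := by
    have := hM.constraints
    omega
  have hTp : ∀ T : List (List (Fin I.n)), (∀ p ∈ T, I.IsGood p ∧ p.length < M) →
      ∀ p ∈ T, p.length < M := fun T h p hp => (h p hp).2
  induction S generalizing T with
  | nil =>
    refine ⟨decide (uncoveredList I.edges T = []), ?_, fun h e he => ?_, fun h => ?_⟩
    · simp only [runs_iff, algorithmBody, Exp.gE]
      simp
      refine (run_uncovered _ _ hM.edges (by simpa using hT) (hTp T hgood)).bind fun t ht => ?_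
      rcases uncoveredList I.edges T with _ | ⟨e, E⟩
      all_goals
        simp [Exp.tt]
        linarith
    · rw [decide_eq_true_eq, uncoveredList, List.filter_eq_nil_iff] at h
      obtain ⟨p, hp, hp'⟩ : ∃ p ∈ T, [e.2, e.1] <:+: p := by simpa using h e he
      exact ⟨p, (hgood p hp).1, hp'⟩
    · rw [decide_eq_false_iff_not] at h
      obtain ⟨e, he⟩ := List.exists_mem_of_ne_nil _ h
      obtain ⟨he, hne⟩ := List.mem_filter.1 he
      exact ⟨e, he, by simpa using hne, by simp⟩
  | cons c S ih =>
    rw [List.forall_mem_cons] at hS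
    have hcM : c.length < M := hS.1.2.trans_lt hM.constraints
    have hmul : (c :: S).length * I.edges.length =
        S.length * I.edges.length + I.edges.length := by
      rw [List.length_cons, Nat.succ_mul]
    rw [hmul] at hT
    have hadmRun := run_admissible I.constraints c hC hcM
    by_cases hadm : Admissible I.constraints c
    · have hTM : T.length < M := by omega
      have hul : (uncoveredList I.edges T).length ≤ I.edges.length := List.length_filter_le _ _
      obtain ⟨T', hrun, hlen, hsub, hgood', hcov⟩ := exists_run_whileEdges hM hS.1.2 hS.1.1 hadm
        (uncoveredList I.edges T) (fun x hx => List.mem_of_mem_filter hx)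
        (hul.trans_lt hM.edges) T
      obtain ⟨b, hb, htrue, hfalse⟩ := ih hS.2 T' (by omega) fun p hp =>
        (hgood' p hp).elim (hgood p) id
      refine ⟨b, ?_, htrue, fun h => ?_⟩
      · simp only [runs_iff, algorithmBody, Exp.gE, Exp.gC]
        simp
        refine hadmRun.bind fun t ht => ?_
        simp [hadm]
        refine (run_uncovered _ _ hM.edges hTM (hTp T hgood)).bind fun t₁ ht₁ => ?_
        refine hrun.bind fun t₂ ht₂ => ?_
        refine hb.bind fun t₃ ht₃ => ⟨rfl, ?_⟩
        have := ht₂.trans ((loop_le (hul.trans_lt hM.edges) _).trans_eq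
          (by ring : M * (6000 * M ^ 4) = 6000 * M ^ 5))
        linarith
      · obtain ⟨e, he, hne, hall⟩ := hfalse h
        have hneT : ¬ ∃ p ∈ T, [e.2, e.1] <:+: p := fun ⟨p, hp, h'⟩ => hne ⟨p, hsub hp, h'⟩
        refine ⟨e, he, hneT, List.forall_mem_cons.2 ⟨fun _ => ?_, hall⟩⟩
        by_contra hp
        exact hne (hcov e (List.mem_filter.2 ⟨he, by simpa using hneT⟩) hp)
    · obtain ⟨b, hb, htrue, hfalse⟩ := ih hS.2 T (by omega) hgood
      refine ⟨b, ?_, htrue, fun h => ?_⟩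
      · simp only [runs_iff, algorithmBody, Exp.gE, Exp.gC]
        simp
        refine hadmRun.bind fun t ht => ?_
        simp [hadm]
        refine hb.bind fun t₁ ht₁ => ⟨rfl, ?_⟩
        linarith
      · obtain ⟨e, he, hne, hall⟩ := hfalse h
        exact ⟨e, he, hne, List.forall_mem_cons.2 ⟨fun h' => absurd h' hadm, hall⟩⟩

/-- Good paths that cover all edges form, read forwards, a test set as desired. -/
theorem exists_achieves (h : ∀ e ∈ I.edges, ∃ p, I.IsGood p ∧ [e.2, e.1] <:+: p) :
    ∃ TS : Set (List (Fin I.n)), I.G.AchievesECNegative TS := by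
  refine ⟨{π | I.IsGood π.reverse}, fun π hπ => ?_, ?_, fun e he => ?_⟩
  · refine ⟨⟨fun h => ?_, ?_⟩, ?_, ?_⟩
    · have := hπ.head
      simp [h] at this
    · exact (List.isChain_reverse.1 hπ.chain).imp fun a b hab => (I.mem_edges _).1 hab
    · rw [← List.getLast?_reverse]
      exact hπ.last
    · rw [← List.head?_reverse]
      exact hπ.head
  · rintro c hc _ hπ p₁ p₂ p₃ rfl
    refine hπ.respects c ((I.mem_constraints c).2 hc) ?_
    rw [← List.reverse_sublist, List.reverse_reverse]
    simp
  · obtain ⟨p, hp, h'⟩ := h e ((I.mem_edges e).2 he)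
    refine ⟨p.reverse, by simpa using hp, ?_⟩
    exact List.reverse_infix.1 (by simpa using h')

/-- A test set as desired yields a proper path through every edge. -/
theorem exists_properPath_of_achieves {TS : Set (List (Fin I.n))}
    (h : I.G.AchievesECNegative TS) {e : Fin I.n × Fin I.n} (he : e ∈ I.edges) :
    ∃ c ∈ sequencesList (criticalList I.constraints),
      Admissible I.constraints c ∧ I.properPath c e.1 e.2 ≠ [] := by
  obtain ⟨hpath, hresp, hcov⟩ := h
  obtain ⟨π, hπ, hπe⟩ := hcov e ((I.mem_edges e).1 he)
  obtain ⟨⟨-, hchain⟩, hhead, hlast⟩ := hpath π hπ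
  refine exists_properPath_ne_nil he (hchain.imp fun a b hab => (I.mem_edges _).2 hab) hhead hlast
    (fun c hc hsub => ?_) hπe
  obtain ⟨r₁, r₂, rfl, h₁, h₂⟩ := List.cons_sublist_iff.1 hsub
  obtain ⟨a, b, rfl⟩ := List.append_of_mem h₁
  obtain ⟨a', b', rfl⟩ := List.append_of_mem (List.singleton_sublist.1 h₂)
  exact hresp c ((I.mem_constraints c).1 hc) _ hπ a (b ++ a') b' (by simp)

/-- The algorithm answers correctly, after at most `10000 * M ^ 6` steps. -/
theorem exists_run_hasEdgeCoverage (hM : I.Fits M)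
    (hF : (2 * I.constraints.length + 1).factorial < M)
    (hS : (2 * I.constraints.length + 1).factorial * I.edges.length < M) :
    ∃ b, Runs .hasEdgeCoverage [I.enc] (encB b) (10000 * M ^ 6) ∧
      (b = true ↔ ∃ TS : Set (List (Fin I.n)), I.G.AchievesECNegative TS) := by
  obtain ⟨h₁, h₂, h₃, h₄⟩ := pow_chain hM.one_le
  have h₀ := hM.one_le
  have h₅ : M ^ 5 ≤ M ^ 6 := Nat.pow_le_pow_right h₀ (by norm_num)
  have hcl := length_criticalList_le I.constraints
  have hfac : ((criticalList I.constraints).length + 1).factorial ≤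
      (2 * I.constraints.length + 1).factorial := Nat.factorial_le (by omega)
  have hsl := (length_sequencesList_le (criticalList I.constraints)).trans hfac
  obtain ⟨b, hb, htrue, hfalse⟩ := exists_run_forSequences hM
    (sequencesList (criticalList I.constraints))
    (fun c hc => ⟨((mem_sequencesList (nodup_criticalList _)).1 hc).1,
      (length_le_of_mem_sequencesList hc).trans hcl⟩) []
    (by simpa using (Nat.mul_le_mul_right _ hsl).trans_lt hS) (by simp)
  refine ⟨b, ?_, fun h => exists_achieves (htrue h), fun ⟨TS, hTS⟩ => ?_⟩
  · simp only [runs_iff, algorithmBody, Exp.gC]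
    simp
    refine (run_critical _ h₀ hM.constraints).bind fun t ht => ?_
    refine (run_sequences _ (hfac.trans_lt hF)).bind fun t₁ ht₁ => ?_
    rw [← encP_nil (n := I.n)]
    refine hb.bind fun t₂ ht₂ => ⟨rfl, ?_⟩
    have := ht₂.trans ((loop_le (hsl.trans_lt hF) _).trans_eq
      (by ring : M * (8000 * M ^ 5) = 8000 * M ^ 6))
    linarith
  · by_contra hb'
    obtain ⟨e, he, -, hall⟩ := hfalse (by simpa using hb')
    obtain ⟨c, hc, hadm, hne⟩ := exists_properPath_of_achieves hTS he
    exact hne (hall c hc hadm)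

theorem length_edges (I : PresentedCCFG) : I.edges.length = I.G.E.card := by
  rw [← List.toFinset_card_of_nodup I.edges_nodup]
  congr 1
  ext e
  rw [List.mem_toFinset, I.mem_edges]

theorem length_constraints (I : PresentedCCFG) : I.constraints.length = I.G.C.card := by
  rw [← List.toFinset_card_of_nodup I.constraints_nodup]
  congr 1
  ext e
  rw [List.mem_toFinset, I.mem_constraints]

/-- A bound for the lengths of all lists that appear in a run of the algorithm: the factorial
bounds the number of sequences, and the square the length of the lists used in the search. -/
def sizeBound (k N : ℕ) : ℕ := 10 * (2 * k + 2).factorial * (N + 1) ^ 2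

theorem fits_sizeBound (I : PresentedCCFG) : I.Fits (sizeBound I.G.C.card (I.n + I.G.E.card)) := by
  rw [← length_edges, ← length_constraints]
  set k := I.constraints.length
  set m := I.edges.length
  have hF := Nat.self_le_factorial (2 * k + 2)
  have h₁ : I.n * m + I.n + m + 1 ≤ (I.n + m + 1) ^ 2 := by nlinarith
  have h₂ : 10 * (2 * k + 2) * (I.n * m + I.n + m + 1) ≤ sizeBound k (I.n + m) :=
    Nat.mul_le_mul (Nat.mul_le_mul_left _ hF) h₁
  have h₃ : 1 * (I.n * m + I.n + m + 1) ≤ (2 * k + 2) * (I.n * m + I.n + m + 1) :=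
    Nat.mul_le_mul_right _ (by omega)
  have h₄ : (2 * k + 2) * 1 ≤ (2 * k + 2) * (I.n * m + I.n + m + 1) :=
    Nat.mul_le_mul_left _ (by omega)
  have h₅ : (2 * k + 1) * (2 * (I.n * m + 1)) ≤
      (2 * k + 2) * (2 * (I.n * m + I.n + m + 1)) := Nat.mul_le_mul (by omega) (by omega)
  have h₆ : 0 ≤ I.n * m := Nat.zero_le _
  constructor <;> linarith

end PresentedCCFG

/-- The factor of the running time that depends on the number of constraints only. -/
theorem computable_timeFactor :
    Computable fun k : ℕ => 10000 * (10 * (2 * k + 2).factorial) ^ 6 := by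
  have hfac : Primrec Nat.factorial := by
    have h : Primrec (Nat.rec 1 fun n a => (n + 1) * a : ℕ → ℕ) :=
      Primrec.nat_rec₁ 1 (Primrec.nat_mul.comp (Primrec.succ.comp Primrec.fst) Primrec.snd)
    refine h.of_eq fun n => ?_
    induction n with
    | zero => rfl
    | succ n ih => rw [Nat.factorial_succ, ← ih]
  have hK : Primrec fun k : ℕ => 10 * (2 * k + 2).factorial :=
    Primrec.nat_mul.comp (Primrec.const 10) (hfac.comp (Primrec.nat_add.comp
      (Primrec.nat_mul.comp (Primrec.const 2) Primrec.id) (Primrec.const 2)))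
  have hsq := Primrec.nat_mul.comp hK hK
  have h := Primrec.nat_mul.comp (Primrec.const 10000)
    (Primrec.nat_mul.comp (Primrec.nat_mul.comp hsq hsq) hsq)
  exact (h.of_eq fun k => by ring).to_comp

theorem hasEdgeCoverageWithNegative_decidesWithin (I : PresentedCCFG) :
    hasEdgeCoverageWithNegative.DecidesWithin I.enc
      (∃ TS : Set (List (Fin I.n)), I.G.AchievesECNegative TS)
      (10000 * (10 * (2 * I.G.C.card + 2).factorial) ^ 6 *
        ((Polynomial.X + 1) ^ 12 : Polynomial ℕ).eval (I.n + I.G.E.card)) := by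
  set k := I.G.C.card with hk
  set N := I.n + I.G.E.card with hN
  have hF : (2 * I.constraints.length + 1).factorial ≤ (2 * k + 2).factorial :=
    Nat.factorial_le (by rw [I.length_constraints]; omega)
  have hpos := Nat.factorial_pos (2 * k + 2)
  have hm : I.edges.length ≤ N := by
    rw [I.length_edges]
    omega
  have hbig : (2 * k + 2).factorial * (N + 1) < PresentedCCFG.sizeBound k N := by
    rw [PresentedCCFG.sizeBound]
    nlinarith [Nat.mul_le_mul_left (2 * k + 2).factorial (Nat.le_self_pow two_ne_zero (N + 1))]
  obtain ⟨b, ⟨v, t, heval, rfl, ht⟩, hb⟩ := PresentedCCFG.exists_run_hasEdgeCoverage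
    I.fits_sizeBound
    ((hF.trans (Nat.le_mul_of_pos_right _ (Nat.succ_pos N))).trans_lt hbig)
    ((Nat.mul_le_mul hF (hm.trans N.le_succ)).trans_lt hbig)
  refine ⟨_, t, heval, ht.trans (le_of_eq ?_), ?_⟩
  · simp only [PresentedCCFG.sizeBound, Polynomial.eval_pow, Polynomial.eval_add,
      Polynomial.eval_X, Polynomial.eval_one, ← hk, ← hN]
    ring
  · cases b
    · exact Or.inr ⟨rfl, fun h => by simpa using hb.2 h⟩
    · exact Or.inl ⟨rfl, hb.1 rfl⟩

end CFGTest

theorem mainTheorem5 :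
    (∃ (f : ℕ → ℕ) (p : Polynomial ℕ), Computable f ∧
      ∀ I : CFGTest.PresentedCCFG,
        CFGTest.hasEdgeCoverageWithNegative.DecidesWithin I.enc
          (∃ TS : Set (List (Fin I.n)), I.G.AchievesECNegative TS)
          (f I.G.C.card * p.eval (I.n + I.G.E.card))) ∧
    CFGTest.IsFPT CFGTest.negativeEC := by
  have h : ∃ (f : ℕ → ℕ) (p : Polynomial ℕ), Computable f ∧
      ∀ I : CFGTest.PresentedCCFG,
        CFGTest.hasEdgeCoverageWithNegative.DecidesWithin I.enc
          (∃ TS : Set (List (Fin I.n)), I.G.AchievesECNegative TS)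
          (f I.G.C.card * p.eval (I.n + I.G.E.card)) :=
    ⟨_, _, CFGTest.computable_timeFactor, CFGTest.hasEdgeCoverageWithNegative_decidesWithin⟩
  exact ⟨h, CFGTest.hasEdgeCoverageWithNegative, h⟩
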